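/- Let $d\ge 2$ and $L\ge 1$ be integers and let $\Gamma=\{0,1,\dots,2L-1\}^d$, with $e_1,\dots,e_d$ the standard basis of $\mathbb{Z}^d$. For $x,y\in\Gamma$ write $x\sim_j y$ if $x-y=e_j$ or $x-y=-e_j$ in $(\mathbb{Z}/2L\mathbb{Z})^d$, and $x\sim y$ if $x\sim_j y$ for some $j\in\{1,\dots,d\}$. Let $\psi_{x\sigma},\psi_{x\sigma}^*$ ($x\in\Gamma$, $\sigma\in\{\uparrow,\downarrow\}$) be the annihilation and creation operators on the Fermionic Fock space over $L^2(\Gamma\times\{\uparrow,\downarrow\})$, and let $n_{x\sigma}=\psi_{x\sigma}^*\psi_{x\sigma}$. Call $\varphi:\mathbb{Z}^d\times\mathbb{Z}^d\to\mathbb{R}$ an admissible phase if, for all $x,y,m\in\mathbb{Z}^d$, $$\varphi(x,y)=-\varphi(y,x)\pmod{2\pi},\qquad \varphi(x+2Lm,y)=\varphi(x,y)\pmod{2\pi}.$$ Let $t_1,\dots,t_d>0$, $U_o\in\mathbb{R}$, $U_d\ge 0$, $U_{s,1},U_{s,2},U_{s,3}\ge 0$ and $\beta>0$. With the Pauli matrices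 $P^{(1)},P^{(2)},P^{(3)}$, set $H(\varphi)=H_0(\varphi)+V$, where $$H_0(\varphi)=\sum_{j=1}^d\ \sum_{x,y\in\Gamma,\ x\sim_j y}\ \sum_{\sigma\in\{\uparrow,\downarrow\}} t_j\,e^{i\varphi(x,y)}\,\psi_{x\sigma}^*\psi_{y\sigma},$$ $$V=U_o\sum_{x\in\Gamma}\Big(n_{x\uparrow}-\tfrac12\Big)\Big(n_{x\downarrow}-\tfrac12\Big)+U_d\sum_{x,y\in\Gamma,\ x\sim y}(n_{x\uparrow}+n_{x\downarrow}-1)(n_{y\uparrow}+n_{y\downarrow}-1)$$ $$\qquad+\sum_{j=1}^3U_{s,j}\sum_{x,y\in\Gamma,\ x\sim y}\ \sum_{\sigma,\tau,\mu,\lambda\in\{\uparrow,\downarrow\}}\big(\psi_{x\sigma}^*P^{(j)}_{\sigma,\tau}\psi_{x\tau}\big)\big(\psi_{y\mu}^*P^{(j)}_{\mu,\lambda}\psi_{y\lambda}\big).$$ Then $\operatorname{Tr}e^{-\beta H(\varphi)}$ is a positive real number for every admissible phase $\varphi$. Moreover, let $\theta_L$ be an admissible phase such that, for all $x\in\mathbb{Z}^d$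 and all $j,k,l\in\{1,\dots,d\}$ with $j<k$, $$\theta_L(x+e_j,x)+\theta_L(x+e_j+e_k,x+e_j)+\theta_L(x+e_k,x+e_j+e_k)+\theta_L(x,x+e_k)=\pi\pmod{2\pi},$$ $$\sum_{m=0}^{2L-1}\theta_L\big(x+(m+1)e_l,\,x+me_l\big)=\begin{cases}\pi&\text{if }L\text{ is even}\\0&\text{if }L\text{ is odd}\end{cases}\pmod{2\pi}.$$ Then $$-\frac1\beta\log\big(\operatorname{Tr}e^{-\beta H(\theta_L)}\big)=\min\Big\{-\frac1\beta\log\big(\operatorname{Tr}e^{-\beta H(\varphi)}\big)\ \Big|\ \varphi\text{ an admissible phase}\Big\}.$$ -/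

import Mathlib

open scoped Real Matrix

namespace FluxPhase

/-! ### The Fermionic Fock space over a finite set of modes

The Fermionic Fock space `F_f(L²(M))` over a finite set `M` of modes is realised in its occupation
number basis: the basis vector attached to `S = {a₁ < ⋯ < aₙ} ⊆ M` is `ψ*_{a₁} ⋯ ψ*_{aₙ} Ω`.
Operators on the Fock space are matrices in this orthonormal basis. -/

/-- Operators on the Fermionic Fock space over the finite, linearly ordered set of modes `M`. -/
abbrev FockOp (M : Type) : Type := Matrix (Finset M) (Finset M) ℂ

/-- The annihilation operator `ψ_a`: it maps the basis vector of `S` to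
`(-1) ^ #{b ∈ S | b < a}` times the basis vector of `S \ {a}` if `a ∈ S`, and to `0` otherwise. -/
def annihilation {M : Type} [LinearOrder M] (a : M) : FockOp M :=
  Matrix.of fun T S =>
    if a ∈ S ∧ T = S.erase a then (-1 : ℂ) ^ (S.filter fun b => b < a).card else 0

/-- The creation operator `ψ*_a`, the adjoint of `ψ_a`. -/
def creation {M : Type} [LinearOrder M] (a : M) : FockOp M := (annihilation a)ᴴ

/-! ### The periodic hyper-cubic lattice -/

/-- The lattice `Γ(2L) = {0, 1, …, 2L - 1}^d`. -/
abbrev Site (d L : ℕ) : Type := Fin d → Fin (2 * L)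

/-- The two spin values: `0` is `↑` and `1` is `↓`. -/
abbrev Spin : Type := Fin 2

/-- One-particle labels `Γ(2L) × {↑, ↓}`, ordered lexicographically. -/
abbrev Mode (d L : ℕ) : Type := Lex (Site d L) ×ₗ Spin

/-- The label `(x, σ)`. -/
def mode {d L : ℕ} (x : Site d L) (σ : Spin) : Mode d L := toLex (toLex x, σ)

/-- A site of `Γ(2L)` as a point of `ℤ^d`. -/
def Site.toInt {d L : ℕ} (x : Site d L) : Fin d → ℤ := fun k => ((x k : ℕ) : ℤ)

/-- `x - y = e_j` or `x - y = -e_j` in `(ℤ / 2Lℤ)^d`. -/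
def IsBond {d L : ℕ} (j : Fin d) (x y : Site d L) : Prop :=
  (fun k => ((x.toInt k - y.toInt k : ℤ) : ZMod (2 * L))) = Pi.single j 1 ∨
    (fun k => ((x.toInt k - y.toInt k : ℤ) : ZMod (2 * L))) = -Pi.single j 1

/-! ### Phases and fluxes -/

/-- A phase `φ : ℤ^d × ℤ^d → ℝ`. -/
abbrev Phase (d : ℕ) : Type := (Fin d → ℤ) → (Fin d → ℤ) → ℝ

/-- The standard basis vector `e_j` of `ℤ^d`. -/
def basisVec {d : ℕ} (j : Fin d) : Fin d → ℤ := Pi.single j 1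

/-- The phases allowed on the lattice `Γ(2L)`: modulo `2π` they are anti-symmetric, and periodic
with period `2L` in every direction. -/
structure IsAdmissible {d : ℕ} (L : ℕ) (φ : Phase d) : Prop where
  antisymm : ∀ x y : Fin d → ℤ, φ x y ≡ -φ y x [PMOD (2 * π)]
  periodic : ∀ x y m : Fin d → ℤ, φ (x + (2 * (L : ℤ)) • m) y ≡ φ x y [PMOD (2 * π)]

/-- The flux of `φ` through the plaquette with corners `x`, `x + e_j`, `x + e_j + e_k`,
`x + e_k`. -/
def plaquetteFlux {d : ℕ} (φ : Phase d) (j k : Fin d) (x : Fin d → ℤ) : ℝ :=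
  φ (x + basisVec j) x + φ (x + basisVec j + basisVec k) (x + basisVec j)
    + φ (x + basisVec k) (x + basisVec j + basisVec k) + φ x (x + basisVec k)

/-- The flux of `φ` through the large circle of length `2L` parallel to `e_l` through `x`. -/
def circleFlux {d : ℕ} (L : ℕ) (φ : Phase d) (l : Fin d) (x : Fin d → ℤ) : ℝ :=
  ∑ m ∈ Finset.range (2 * L),
    φ (x + ((m : ℤ) + 1) • basisVec l) (x + (m : ℤ) • basisVec l)

/-! ### The Hamiltonian -/

open Classical in
/-- The free Hamiltonian
`H₀(φ) = ∑_{x,y} ∑_σ 1_{x - y = ± e_j for some j} t_j e^{i φ(x,y)} ψ*_{xσ} ψ_{yσ}`.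
The direction `j` of a bond is unique since `2L ≥ 2`, so that one may sum over `j`. -/
noncomputable def freeHamiltonian {d : ℕ} (L : ℕ) (t : Fin d → ℝ) (φ : Phase d) :
    FockOp (Mode d L) :=
  ∑ x : Site d L, ∑ y : Site d L, ∑ σ : Spin, ∑ j : Fin d,
    if IsBond j x y then
      ((t j : ℂ) * Complex.exp (Complex.I * (φ x.toInt y.toInt : ℂ))) •
        (creation (mode x σ) * annihilation (mode y σ))
    else 0

/-- The number operator `ψ*_{xσ} ψ_{xσ}`. -/
noncomputable def number {d L : ℕ} (x : Site d L) (σ : Spin) : FockOp (Mode d L) :=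
  creation (mode x σ) * annihilation (mode x σ)

/-- The Pauli matrices. -/
def pauli : Fin 3 → Matrix Spin Spin ℂ :=
  ![!![0, 1; 1, 0], !![0, -Complex.I; Complex.I, 0], !![1, 0; 0, -1]]

open Classical in
/-- The interaction with coupling constants `Uo` (on-site), `Ud` (nearest-neighbour density-density)
and `Us j` (nearest-neighbour spin-spin); the sums run over ordered pairs `(x, y)`. -/
noncomputable def interaction (d L : ℕ) (Uo Ud : ℝ) (Us : Fin 3 → ℝ) : FockOp (Mode d L) :=
  (Uo : ℂ) • ∑ x : Site d L, (number x 0 - (1 / 2 : ℂ) • 1) * (number x 1 - (1 / 2 : ℂ) • 1)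
  + (Ud : ℂ) • ∑ x : Site d L, ∑ y : Site d L,
      (if ∃ k, IsBond k x y then
        (number x 0 + number x 1 - 1) * (number y 0 + number y 1 - 1)
      else 0)
  + ∑ j : Fin 3, (Us j : ℂ) • ∑ x : Site d L, ∑ y : Site d L,
      ∑ σ : Spin, ∑ τ : Spin, ∑ μ : Spin, ∑ ν : Spin,
        (if ∃ k, IsBond k x y then
          (pauli j σ τ • (creation (mode x σ) * annihilation (mode x τ))) *
            (pauli j μ ν • (creation (mode y μ) * annihilation (mode y ν)))
        else 0)

/-- The Hamiltonian `H(φ) = H₀(φ) + V`. -/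
noncomputable def hamiltonian {d : ℕ} (L : ℕ) (t : Fin d → ℝ) (Uo Ud : ℝ) (Us : Fin 3 → ℝ)
    (φ : Phase d) : FockOp (Mode d L) :=
  freeHamiltonian L t φ + interaction d L Uo Ud Us

/-- The partition function `Tr e^{-β H(φ)}`. -/
noncomputable def partitionFunction {d : ℕ} (L : ℕ) (t : Fin d → ℝ) (Uo Ud : ℝ) (Us : Fin 3 → ℝ)
    (β : ℝ) (φ : Phase d) : ℂ :=
  (NormedSpace.exp ((-β : ℂ) • hamiltonian L t Uo Ud Us φ)).trace

/-- The free energy `-(1/β) log (Tr e^{-β H(φ)})`. -/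
noncomputable def freeEnergy {d : ℕ} (L : ℕ) (t : Fin d → ℝ) (Uo Ud : ℝ) (Us : Fin 3 → ℝ)
    (β : ℝ) (φ : Phase d) : ℝ :=
  -(1 / β) * Real.log (partitionFunction L t Uo Ud Us β φ).re

end FluxPhase

/-!
The proof is reflection positivity in the form which Lieb used for the flux phase at half filling.

The Fock space over the modes of the torus is the doubled Fock space over the modes of one half
(`exists_splitHom`). Performing a particle-hole transformation on the right half, and inserting
Fermion parities, one can arrange that the Hamiltonian becomes
`A ⊗ 1 + 1 ⊗ conj B - ∑ C ⊗ conj C` as soon as the phase of the hopping between each site and its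
mirror image is `-1` (`IsDoubled.exists_hubbard`): the one-site observables which enter the
interaction are odd under reflection combined with complex conjugation and the particle-hole
transformation, so that repulsive couplings between the halves come with the right sign, and the
hopping between the halves has the form `C ⊗ conj C` by itself. Expanding the exponential as a limit
of powers of sums of terms `X ⊗ conj Y` and using the Cauchy-Schwarz inequality gives
`Z(A, B)² ≤ Z(A, A) Z(B, B)` (`norm_trace_exp_sq_le`). In terms of phases: a gauge field can be
replaced by one of its two reflections, `fold`, without decreasing the partition function. The
particle-hole transformation changes the sign of the reflected hopping amplitudes, and this is what
produces the canonical fluxes: after the reflection, each plaquette which crosses the reflection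
plane has flux `π`, and each large circle which crosses it has flux `(L - 1) π`
(`hasCanonicalFlux_fold_of_isCut`), whereas the fluxes away from the plane are those of the kept
half.

Gauge fields form a compact space, so a maximizer of the partition function exists. Counting loops
with a wrong flux, the two reflections together have fewer than twice as many of them as the
original field if one such loop crosses the plane (`badLoops_fold_lt`). Since both reflections of
a maximizer are maximizers, there is a maximizer all of whose fluxes are canonical
(`exists_maximizer`). The partition function depends only on the fluxes through plaquettes and large
circles, because a flat connection on the torus with trivial holonomies is a pure gauge
(`exists_gauge_of_flat`), so every phase with the canonical fluxes is a maximizer. Positivity of the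
partition function holds as the Hamiltonian is Hermitian.
-/

namespace FluxPhase

/-! ### Powers converging to the exponential -/

section Analysis

open Filter Topology

theorem norm_pow_sub_pow_le {A : Type*} [NormedRing A] [NormOneClass A] {a b : A} {M : ℝ}
    (ha : ‖a‖ ≤ M) (hb : ‖b‖ ≤ M) (n : ℕ) :
    ‖a ^ (n + 1) - b ^ (n + 1)‖ ≤ (n + 1) * M ^ n * ‖a - b‖ := by
  have hM : 0 ≤ M := (norm_nonneg a).trans ha
  induction n with
  | zero => simp
  | succ n ih =>
    have h : a ^ (n + 1 + 1) - b ^ (n + 1 + 1)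
        = a ^ (n + 1) * (a - b) + (a ^ (n + 1) - b ^ (n + 1)) * b := by
      rw [pow_succ a (n + 1), pow_succ b (n + 1)]; noncomm_ring
    rw [h]
    have h1 : ‖a ^ (n + 1)‖ ≤ M ^ (n + 1) :=
      (norm_pow_le a (n + 1)).trans (pow_le_pow_left₀ (norm_nonneg a) ha _)
    calc ‖a ^ (n + 1) * (a - b) + (a ^ (n + 1) - b ^ (n + 1)) * b‖
        ≤ ‖a ^ (n + 1)‖ * ‖a - b‖ + ‖a ^ (n + 1) - b ^ (n + 1)‖ * ‖b‖ :=
          (norm_add_le _ _).trans (add_le_add (norm_mul_le _ _) (norm_mul_le _ _))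
      _ ≤ M ^ (n + 1) * ‖a - b‖ + ((n + 1) * M ^ n * ‖a - b‖) * M := by gcongr
      _ = ((n + 1 : ℕ) + 1) * M ^ (n + 1) * ‖a - b‖ := by push_cast; ring

/-- If `n (aₙ - 1) → H` in a Banach algebra then `aₙ ^ n → e^H`: both `aₙ` and `e^{H/n}` have norm
at most `e^{c/n}`, and they differ by `o(1/n)`. -/
theorem tendsto_pow_exp {A : Type*} [NormedRing A] [NormedAlgebra ℝ A] [NormOneClass A]
    [CompleteSpace A] {H : A} {a : ℕ → A}
    (ha : Tendsto (fun n : ℕ => (n : ℝ) • (a n - 1)) atTop (𝓝 H)) :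
    Tendsto (fun n : ℕ => a n ^ n) atTop (𝓝 (NormedSpace.exp H)) := by
  have hb : Tendsto (fun n : ℕ => (n : ℝ) • (NormedSpace.exp ((n : ℝ)⁻¹ • H) - 1)) atTop (𝓝 H) := by
    have h := (hasDerivAt_exp_smul_const (𝕂 := ℝ) H (0 : ℝ)).tendsto_slope
    simp only [zero_smul, NormedSpace.exp_zero, one_mul] at h
    have h2 : Tendsto (fun n : ℕ => ((n : ℝ))⁻¹) atTop (𝓝[≠] 0) := by
      refine tendsto_nhdsWithin_iff.2 ⟨tendsto_inv_atTop_nhds_zero_nat, ?_⟩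
      filter_upwards [eventually_gt_atTop 0] with n hn
      simp; omega
    have h3 := h.comp h2
    refine h3.congr fun n => ?_
    simp [slope]
  obtain ⟨b, hbdef⟩ : ∃ b : ℕ → A, ∀ n : ℕ, b n = NormedSpace.exp ((n : ℝ)⁻¹ • H) :=
    ⟨_, fun _ => rfl⟩
  simp only [← hbdef] at hb
  have bound : ∀ {x : ℕ → A}, Tendsto (fun n : ℕ => (n : ℝ) • (x n - 1)) atTop (𝓝 H) →
      ∀ᶠ n : ℕ in atTop, ‖x n‖ ≤ Real.exp ((‖H‖ + 1) / n) := by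
    intro x hx
    have h1 : ∀ᶠ n : ℕ in atTop, ‖(n : ℝ) • (x n - 1)‖ < ‖H‖ + 1 :=
      hx.norm.eventually (gt_mem_nhds (lt_add_one _))
    filter_upwards [h1, eventually_gt_atTop 0] with n hn hn0
    have hn' : (0 : ℝ) < n := by exact_mod_cast hn0
    rw [norm_smul, Real.norm_natCast] at hn
    have h2 : ‖x n - 1‖ ≤ (‖H‖ + 1) / n := by
      rw [le_div_iff₀ hn']; linarith
    have h3 : ‖x n‖ ≤ ‖x n - 1‖ + 1 := by
      have := norm_add_le (x n - 1) 1
      simpa using this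
    linarith [Real.add_one_le_exp ((‖H‖ + 1) / (n : ℝ))]
  have hbn : ∀ᶠ n : ℕ in atTop, b n ^ n = NormedSpace.exp H := by
    filter_upwards [eventually_gt_atTop 0] with n hn
    have hn' : ((n : ℝ)) ≠ 0 := by positivity
    let _ : NormedAlgebra ℚ A := NormedAlgebra.restrictScalars ℚ ℝ A
    rw [hbdef, ← NormedSpace.exp_nsmul, ← Nat.cast_smul_eq_nsmul ℝ, smul_smul, mul_inv_cancel₀ hn',
      one_smul]
  have hdiff : Tendsto (fun n : ℕ => Real.exp (‖H‖ + 1) * ‖(n : ℝ) • (a n - b n)‖) atTop (𝓝 0) := by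
    have h := ((ha.sub hb).norm).const_mul (Real.exp (‖H‖ + 1))
    simp only [sub_self, norm_zero, mul_zero] at h
    refine h.congr fun n => ?_
    rw [← smul_sub]; congr 3; abel
  have hlim : Tendsto (fun n : ℕ => a n ^ n - b n ^ n) atTop (𝓝 0) := by
    refine squeeze_zero_norm' ?_ hdiff
    filter_upwards [bound ha, bound hb, eventually_gt_atTop 0] with n h1 h2 hn
    obtain ⟨m, rfl⟩ := Nat.exists_eq_add_of_lt hn
    simp only [zero_add] at h1 h2 ⊢
    have hm : (0 : ℝ) < ((m + 1 : ℕ) : ℝ) := by positivity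
    refine (norm_pow_sub_pow_le h1 h2 m).trans ?_
    rw [norm_smul, Real.norm_natCast, ← Real.exp_nat_mul]
    have : Real.exp (m * ((‖H‖ + 1) / ((m + 1 : ℕ) : ℝ))) ≤ Real.exp (‖H‖ + 1) := by
      apply Real.exp_le_exp.2
      rw [mul_div_assoc', div_le_iff₀ hm]
      push_cast
      nlinarith [norm_nonneg H]
    have h0 : 0 ≤ ‖a (m + 1) - b (m + 1)‖ := norm_nonneg _
    push_cast
    calc ((m : ℝ) + 1) * Real.exp (m * ((‖H‖ + 1) / ((m : ℝ) + 1))) * ‖a (m + 1) - b (m + 1)‖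
        ≤ ((m : ℝ) + 1) * Real.exp (‖H‖ + 1) * ‖a (m + 1) - b (m + 1)‖ := by
          push_cast at this; gcongr
      _ = _ := by ring
  have := hlim.add (tendsto_const_nhds (x := NormedSpace.exp H))
  rw [zero_add] at this
  refine this.congr' ?_
  filter_upwards [hbn] with n hn
  rw [hn]; abel

end Analysis

/-! ### Doubling a matrix algebra -/

section Doubling

variable {n : Type} [Fintype n] [DecidableEq n]

open scoped Kronecker

/-- The embedding `X ↦ X ⊗ 1` of operators on the left half. -/
def leftHom : Matrix n n ℂ →ₐ[ℂ] Matrix (n × n) (n × n) ℂ :=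
  AlgHom.ofLinearMap
    { toFun := fun X => X ⊗ₖ (1 : Matrix n n ℂ)
      map_add' := fun X Y => Matrix.add_kronecker X Y 1
      map_smul' := fun r X => Matrix.smul_kronecker r X 1 }
    Matrix.one_kronecker_one
    (fun X Y => by simp [← Matrix.mul_kronecker_mul])

/-- The embedding `Y ↦ 1 ⊗ conj Y` of operators on the left half as operators on the right half.
It is complex conjugate linear. -/
def rightHom : Matrix n n ℂ →+* Matrix (n × n) (n × n) ℂ where
  toFun Y := (1 : Matrix n n ℂ) ⊗ₖ Y.map (starRingEnd ℂ)
  map_one' := by simp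
  map_mul' X Y := by
    rw [Matrix.map_mul, ← Matrix.mul_kronecker_mul, one_mul]
  map_zero' := by simp
  map_add' X Y := by
    rw [Matrix.map_add _ (map_add _), Matrix.kronecker_add]

theorem leftHom_apply (X : Matrix n n ℂ) : leftHom X = X ⊗ₖ (1 : Matrix n n ℂ) := rfl

theorem rightHom_apply (Y : Matrix n n ℂ) :
    rightHom Y = (1 : Matrix n n ℂ) ⊗ₖ Y.map (starRingEnd ℂ) := rfl

theorem rightHom_smul (r : ℂ) (Y : Matrix n n ℂ) :
    rightHom (r • Y) = (starRingEnd ℂ r) • rightHom Y := by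
  rw [rightHom_apply, rightHom_apply, ← Matrix.kronecker_smul]
  congr 1
  ext i j
  simp

theorem leftHom_mul_rightHom (X Y : Matrix n n ℂ) :
    leftHom X * rightHom Y = X ⊗ₖ Y.map (starRingEnd ℂ) := by
  rw [leftHom_apply, rightHom_apply, ← Matrix.mul_kronecker_mul, mul_one, one_mul]

theorem rightHom_mul_leftHom (X Y : Matrix n n ℂ) :
    rightHom Y * leftHom X = leftHom X * rightHom Y := by
  rw [leftHom_mul_rightHom, leftHom_apply, rightHom_apply, ← Matrix.mul_kronecker_mul, mul_one,
    one_mul]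

theorem leftHom_conjTranspose (X : Matrix n n ℂ) : leftHom Xᴴ = (leftHom X)ᴴ := by
  rw [leftHom_apply, leftHom_apply, Matrix.conjTranspose_kronecker, Matrix.conjTranspose_one]

theorem rightHom_conjTranspose (X : Matrix n n ℂ) : rightHom Xᴴ = (rightHom X)ᴴ := by
  rw [rightHom_apply, rightHom_apply, Matrix.conjTranspose_kronecker, Matrix.conjTranspose_one]
  congr 1

theorem trace_leftHom_mul_rightHom (X Y : Matrix n n ℂ) :
    (leftHom X * rightHom Y).trace = X.trace * (starRingEnd ℂ) Y.trace := by
  rw [leftHom_mul_rightHom, Matrix.trace_kronecker]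
  congr 1
  simp [Matrix.trace]

/-- The powers of `∑ Xᵢ ⊗ conj Yᵢ` have the same shape, with words in the `Xᵢ` and the same words
in the `Yᵢ`. The words do not depend on the choice of `Y`, which is why three powers are expanded at
once. -/
theorem exists_words {ι : Type} [Fintype ι] (X Y : ι → Matrix n n ℂ) (N : ℕ) :
    ∃ (κ : Type) (_ : Fintype κ) (X' Y' : κ → Matrix n n ℂ),
      (∑ i, leftHom (X i) * rightHom (Y i)) ^ N = ∑ k, leftHom (X' k) * rightHom (Y' k) ∧
      (∑ i, leftHom (X i) * rightHom (X i)) ^ N = ∑ k, leftHom (X' k) * rightHom (X' k) ∧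
      (∑ i, leftHom (Y i) * rightHom (Y i)) ^ N = ∑ k, leftHom (Y' k) * rightHom (Y' k) := by
  induction N with
  | zero => exact ⟨Unit, inferInstance, fun _ => 1, fun _ => 1, by simp⟩
  | succ N ih =>
    obtain ⟨κ, _, X', Y', h1, h2, h3⟩ := ih
    have key : ∀ A C B D : Matrix n n ℂ, leftHom A * rightHom C * (leftHom B * rightHom D)
        = leftHom (A * B) * rightHom (C * D) := fun A C B D => by
      rw [map_mul, map_mul, mul_assoc, ← mul_assoc (rightHom C), rightHom_mul_leftHom]
      simp only [mul_assoc]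
    refine ⟨κ × ι, inferInstance, fun k => X' k.1 * X k.2, fun k => Y' k.1 * Y k.2, ?_, ?_, ?_⟩
    · rw [pow_succ, h1, Finset.sum_mul_sum, Fintype.sum_prod_type]
      simp only [key]
    · rw [pow_succ, h2, Finset.sum_mul_sum, Fintype.sum_prod_type]
      simp only [key]
    · rw [pow_succ, h3, Finset.sum_mul_sum, Fintype.sum_prod_type]
      simp only [key]

theorem norm_trace_pow_sq_le {ι : Type} [Fintype ι] (X Y : ι → Matrix n n ℂ) (N : ℕ) :
    ‖((∑ i, leftHom (X i) * rightHom (Y i)) ^ N).trace‖ ^ 2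
      ≤ ((∑ i, leftHom (X i) * rightHom (X i)) ^ N).trace.re
        * ((∑ i, leftHom (Y i) * rightHom (Y i)) ^ N).trace.re := by
  obtain ⟨κ, _, X', Y', h1, h2, h3⟩ := exists_words X Y N
  rw [h1, h2, h3]
  simp only [Matrix.trace_sum, trace_leftHom_mul_rightHom, Complex.re_sum, Complex.mul_conj,
    Complex.ofReal_re, Complex.normSq_eq_norm_sq]
  have h : ‖∑ k, (X' k).trace * (starRingEnd ℂ) (Y' k).trace‖
      ≤ ∑ k, ‖(X' k).trace‖ * ‖(Y' k).trace‖ := by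
    refine (norm_sum_le _ _).trans (le_of_eq ?_)
    simp
  exact (pow_le_pow_left₀ (norm_nonneg _) h 2).trans (Finset.sum_mul_sq_le_sq_mul_sq _ _ _)

open Filter Topology in
/-- The exponential of `A ⊗ 1 + 1 ⊗ conj B + ∑ Cᵢ ⊗ conj Cᵢ` is a limit of powers of sums of terms
`X ⊗ conj Y`. -/
theorem tendsto_trace_pow [Nonempty n] {ι : Type} [Fintype ι] (A B : Matrix n n ℂ)
    (C : ι → Matrix n n ℂ) :
    Tendsto (fun N : ℕ => ((∑ i : Option ι,
        leftHom (i.elim (1 + (N : ℝ)⁻¹ • A) fun i => √((N : ℝ)⁻¹) • C i)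
          * rightHom (i.elim (1 + (N : ℝ)⁻¹ • B) fun i => √((N : ℝ)⁻¹) • C i)) ^ N).trace) atTop
      (𝓝 (NormedSpace.exp
        (leftHom A + rightHom B + ∑ i, leftHom (C i) * rightHom (C i))).trace) := by
  let _ : NormedRing (Matrix (n × n) (n × n) ℂ) := Matrix.linftyOpNormedRing
  let _ : NormedAlgebra ℝ (Matrix (n × n) (n × n) ℂ) := Matrix.linftyOpNormedAlgebra
  have _ : NormOneClass (Matrix (n × n) (n × n) ℂ) := Matrix.linfty_opNormOneClass
  have _ : CompleteSpace (Matrix (n × n) (n × n) ℂ) := FiniteDimensional.complete ℝ _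
  have hl : ∀ (r : ℝ) (X : Matrix n n ℂ), leftHom (r • X) = r • leftHom X := fun r X => by
    have : r • X = (r : ℂ) • X := by ext; simp
    rw [this, map_smul]; ext; simp
  have hr : ∀ (r : ℝ) (X : Matrix n n ℂ), rightHom (r • X) = r • rightHom X := fun r X => by
    have : r • X = (r : ℂ) • X := by ext; simp
    rw [this, rightHom_smul]; ext; simp
  have key : Tendsto (fun N : ℕ => (∑ i : Option ι,
        leftHom (i.elim (1 + (N : ℝ)⁻¹ • A) fun i => √((N : ℝ)⁻¹) • C i)
          * rightHom (i.elim (1 + (N : ℝ)⁻¹ • B) fun i => √((N : ℝ)⁻¹) • C i)) ^ N) atTop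
      (𝓝 (NormedSpace.exp
        (leftHom A + rightHom B + ∑ i, leftHom (C i) * rightHom (C i)))) := by
    apply tendsto_pow_exp
    have h0 : Tendsto (fun N : ℕ => leftHom A + rightHom B + ∑ i, leftHom (C i) * rightHom (C i)
        + (N : ℝ)⁻¹ • (leftHom A * rightHom B)) atTop
        (𝓝 (leftHom A + rightHom B + ∑ i, leftHom (C i) * rightHom (C i))) := by
      have := (tendsto_inv_atTop_nhds_zero_nat (𝕜 := ℝ)).smul_const (leftHom A * rightHom B)
      rw [zero_smul] at this
      simpa using this.const_add
        (leftHom A + rightHom B + ∑ i, leftHom (C i) * rightHom (C i))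
    refine h0.congr' ?_
    filter_upwards [eventually_gt_atTop 0] with N hN
    have hN' : (N : ℝ) ≠ 0 := by positivity
    rw [Fintype.sum_option]
    simp only [Option.elim_none, Option.elim_some, map_add, map_one, hl, hr]
    have hC : ∀ i, (√((N : ℝ)⁻¹) • leftHom (C i)) * (√((N : ℝ)⁻¹) • rightHom (C i))
        = (N : ℝ)⁻¹ • (leftHom (C i) * rightHom (C i)) := fun i => by
      rw [smul_mul_smul_comm, Real.mul_self_sqrt (by positivity)]
    simp only [hC, ← Finset.smul_sum]
    simp only [add_mul, mul_add, one_mul, mul_one, smul_mul_assoc, mul_smul_comm, smul_add,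
      smul_sub, smul_smul]
    rw [mul_inv_cancel₀ hN', ← mul_assoc, mul_inv_cancel₀ hN']
    simp only [one_smul, one_mul]
    abel
  exact ((continuous_id.matrix_trace).tendsto _).comp key

/-- Reflection positivity: the partition function of `A ⊗ 1 + 1 ⊗ conj B + ∑ Cᵢ ⊗ conj Cᵢ`
satisfies a Cauchy-Schwarz inequality in the pair `(A, B)`. -/
theorem norm_trace_exp_sq_le [Nonempty n] {ι : Type} [Fintype ι] (A B : Matrix n n ℂ)
    (C : ι → Matrix n n ℂ) :
    ‖(NormedSpace.exp (leftHom A + rightHom B + ∑ i, leftHom (C i) * rightHom (C i))).trace‖ ^ 2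
      ≤ (NormedSpace.exp
          (leftHom A + rightHom A + ∑ i, leftHom (C i) * rightHom (C i))).trace.re
        * (NormedSpace.exp
          (leftHom B + rightHom B + ∑ i, leftHom (C i) * rightHom (C i))).trace.re := by
  refine le_of_tendsto_of_tendsto' ((tendsto_trace_pow A B C).norm.pow 2)
    (((Complex.continuous_re.tendsto _).comp (tendsto_trace_pow A A C)).mul
      ((Complex.continuous_re.tendsto _).comp (tendsto_trace_pow B B C))) fun N => ?_
  exact norm_trace_pow_sq_le _ _ N

end Doubling

/-! ### Partition functions of Hermitian matrices -/

open scoped ComplexOrder in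
theorem trace_exp_pos {n : Type} [Fintype n] [DecidableEq n] [Nonempty n] {H : Matrix n n ℂ}
    (hH : H.IsHermitian) :
    (NormedSpace.exp H).trace.im = 0 ∧ 0 < (NormedSpace.exp H).trace.re := by
  set E := NormedSpace.exp ((1 / 2 : ℝ) • H) with hE
  have hEh : E.IsHermitian := Matrix.IsHermitian.exp (by
    rw [Matrix.IsHermitian, Matrix.conjTranspose_smul, hH.eq]; simp)
  have h2 : NormedSpace.exp H = Eᴴ * E := by
    rw [hEh.eq, hE, ← Matrix.exp_add_of_commute _ _ (Commute.refl _), ← add_smul]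
    norm_num
  have hpd : (Eᴴ * E).PosDef := by
    apply Matrix.PosDef.conjTranspose_mul_self
    exact Matrix.mulVec_injective_of_isUnit (Matrix.isUnit_exp _)
  have := hpd.trace_pos
  rw [h2]
  rw [Complex.lt_def] at this
  exact ⟨this.2.symm, this.1⟩

/-- The real part is the form in which partition functions enter the free energy; it depends
continuously on the Hamiltonian. -/
theorem continuous_trace_exp {n : Type} [Fintype n] [DecidableEq n] :
    Continuous fun H : Matrix n n ℂ => (NormedSpace.exp H).trace.re := by
  let _ : NormedRing (Matrix n n ℂ) := Matrix.linftyOpNormedRing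
  let _ : NormedAlgebra ℝ (Matrix n n ℂ) := Matrix.linftyOpNormedAlgebra
  let _ : NormedAlgebra ℚ (Matrix n n ℂ) := NormedAlgebra.restrictScalars ℚ ℝ _
  have _ : CompleteSpace (Matrix n n ℂ) := FiniteDimensional.complete ℝ _
  exact Complex.continuous_re.comp (NormedSpace.exp_continuous.matrix_trace)

/-! ### Canonical anticommutation relations -/

section CAR

variable {M : Type} [LinearOrder M]

/-- The sign `(-1) ^ #{b ∈ S | b < a}` picked up by `ψ_a` on the basis vector of `S`. -/
def modeSign (a : M) (S : Finset M) : ℂ := (-1) ^ (S.filter fun b => b < a).card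

theorem modeSign_mul_self (a : M) (S : Finset M) : modeSign a S * modeSign a S = 1 := by
  rw [modeSign, ← mul_pow]; simp

theorem modeSign_conj (a : M) (S : Finset M) :
    (starRingEnd ℂ) (modeSign a S) = modeSign a S := by
  simp [modeSign]

theorem norm_modeSign (a : M) (S : Finset M) : ‖modeSign a S‖ = 1 := by
  simp [modeSign]

theorem modeSign_insert (a b : M) {S : Finset M} (hb : b ∉ S) :
    modeSign a (insert b S) = modeSign a S * if b < a then -1 else 1 := by
  unfold modeSign
  rw [Finset.filter_insert]
  split_ifs with h
  · rw [Finset.card_insert_of_notMem (by simp [hb]), pow_succ]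
  · simp

theorem modeSign_erase (a b : M) {S : Finset M} (hb : b ∈ S) :
    modeSign a (S.erase b) = modeSign a S * if b < a then -1 else 1 := by
  conv_rhs => rw [← Finset.insert_erase hb, modeSign_insert a b (Finset.notMem_erase b S)]
  rw [mul_assoc]
  split_ifs <;> simp

theorem modeSign_erase_self (a : M) (S : Finset M) : modeSign a (S.erase a) = modeSign a S := by
  by_cases h : a ∈ S
  · simp [modeSign_erase a a h]
  · rw [Finset.erase_eq_of_notMem h]

theorem annihilation_apply (a : M) (T S : Finset M) :
    annihilation a T S = if a ∈ S ∧ T = S.erase a then modeSign a S else 0 := rfl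

theorem creation_apply (a : M) (T S : Finset M) :
    creation a T S = if a ∉ S ∧ T = insert a S then modeSign a S else 0 := by
  have h : (a ∈ T ∧ S = T.erase a) ↔ (a ∉ S ∧ T = insert a S) := by
    constructor
    · rintro ⟨h, rfl⟩; simp [Finset.insert_erase h]
    · rintro ⟨h, rfl⟩; simp [Finset.erase_insert h]
  rw [creation, Matrix.conjTranspose_apply, annihilation_apply]
  by_cases h' : a ∈ T ∧ S = T.erase a
  · rw [if_pos h', if_pos (h.1 h'), h'.2, modeSign_erase_self]
    exact modeSign_conj a T
  · rw [if_neg h', if_neg (fun h2 => h' (h.2 h2)), star_zero]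

/-- The Fermion parity `(-1) ^ N`. -/
def parity (M : Type) [DecidableEq M] : FockOp M := Matrix.diagonal fun S => (-1) ^ S.card

theorem parity_conjTranspose : (parity M)ᴴ = parity M := by
  rw [parity, Matrix.diagonal_conjTranspose]
  congr 1
  ext S
  simp

variable [Fintype M]

theorem mul_annihilation_apply {m : Type} (X : Matrix m (Finset M) ℂ) (b : M) (T : m)
    (S : Finset M) :
    (X * annihilation b) T S = if b ∈ S then X T (S.erase b) * modeSign b S else 0 := by
  rw [Matrix.mul_apply]
  simp only [annihilation_apply]
  split_ifs with h
  · simp [h]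
  · simp [h]

theorem mul_creation_apply {m : Type} (X : Matrix m (Finset M) ℂ) (b : M) (T : m)
    (S : Finset M) :
    (X * creation b) T S = if b ∉ S then X T (insert b S) * modeSign b S else 0 := by
  rw [Matrix.mul_apply]
  simp only [creation_apply]
  split_ifs with h
  · simp [h]
  · simp [h]

theorem annihilation_mul_annihilation (a b : M) :
    annihilation a * annihilation b = -(annihilation b * annihilation a) := by
  ext T S
  rw [Matrix.neg_apply, mul_annihilation_apply, mul_annihilation_apply]
  by_cases hab : a = b
  · subst hab
    simp [annihilation_apply]
  by_cases ha : a ∈ S <;> by_cases hb : b ∈ S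
  · simp only [ha, hb, if_true, annihilation_apply, Finset.mem_erase, ne_eq, hab, Ne.symm hab,
      not_false_eq_true, true_and, Finset.erase_right_comm (a := b) (b := a)]
    have h1 := modeSign_erase a b hb
    have h2 := modeSign_erase b a ha
    by_cases hT : T = (S.erase a).erase b
    · simp only [hT, if_true, h1, h2]
      rcases lt_or_gt_of_ne hab with h | h
      · simp only [h, h.not_gt, if_true, if_false]; ring
      · simp only [h, h.not_gt, if_true, if_false]; ring
    · simp [hT]
  all_goals simp [ha, hb, annihilation_apply]

theorem annihilation_mul_creation (a b : M) :
    annihilation a * creation b = (if a = b then 1 else 0) - creation b * annihilation a := by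
  ext T S
  rw [Matrix.sub_apply, mul_annihilation_apply, mul_creation_apply]
  by_cases hab : a = b
  · subst hab
    rw [if_pos rfl]
    by_cases ha : a ∈ S
    · simp only [ha, not_true_eq_false, if_false, if_true, creation_apply, Finset.mem_erase,
        ne_eq, false_and, not_false_eq_true, true_and, Finset.insert_erase, modeSign_erase_self,
        Matrix.one_apply, ite_mul, modeSign_mul_self, zero_mul, sub_self]
    · simp only [ha, not_false_eq_true, if_true, if_false, annihilation_apply,
        Finset.mem_insert_self, Finset.erase_insert, true_and, ite_mul, zero_mul, sub_zero,
        Matrix.one_apply, modeSign_insert, lt_irrefl, mul_one, modeSign_mul_self]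
  · rw [if_neg hab]
    by_cases ha : a ∈ S <;> by_cases hb : b ∈ S
    · simp [ha, hb, creation_apply, Ne.symm hab]
    · have h1 := modeSign_insert a b hb
      have h2 := modeSign_erase b a ha
      simp only [ha, hb, if_true, not_false_eq_true, annihilation_apply, creation_apply,
        Finset.mem_insert, or_true, true_and, Finset.mem_erase, and_false,
        Finset.erase_insert_of_ne (Ne.symm hab), h1, h2, Matrix.zero_apply]
      by_cases hT : T = insert b (S.erase a)
      · rcases lt_or_gt_of_ne hab with h | h
        · simp only [hT, h, h.not_gt, if_true, if_false]; ring
        · simp only [hT, h, h.not_gt, if_true, if_false]; ring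
      · simp [hT]
    · simp [ha, hb]
    · simp [ha, hb, annihilation_apply, hab]

theorem parity_mul_parity : parity M * parity M = 1 := by
  simp only [parity, Matrix.diagonal_mul_diagonal, ← mul_pow]
  simp

theorem parity_mul_annihilation (a : M) :
    parity M * annihilation a = -(annihilation a * parity M) := by
  ext T S
  rw [Matrix.neg_apply, parity, Matrix.diagonal_mul, Matrix.mul_diagonal, annihilation_apply]
  by_cases h : a ∈ S ∧ T = S.erase a
  · rw [if_pos h, h.2, ← Finset.card_erase_add_one h.1, pow_succ]; ring
  · simp [h]

theorem creation_mul_parity (a : M) :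
    creation a * parity M = -(parity M * creation a) := by
  have h := congrArg Matrix.conjTranspose (parity_mul_annihilation a)
  rwa [Matrix.conjTranspose_mul, Matrix.conjTranspose_neg, Matrix.conjTranspose_mul,
    parity_conjTranspose] at h

theorem creation_mul_creation (a b : M) :
    creation a * creation b = -(creation b * creation a) := by
  have h := congrArg Matrix.conjTranspose (annihilation_mul_annihilation b a)
  rwa [Matrix.conjTranspose_mul, Matrix.conjTranspose_neg, Matrix.conjTranspose_mul] at h

end CAR

/-! ### Families of matrices which are annihilation operators up to signs -/

section FlatSign

variable {M : Type} [LinearOrder M]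

/-- The product of the weights `g` along the path from `S` to `∅` which removes the largest
element in each step. -/
noncomputable def pathWeight (g : M → Finset M → ℂ) (S : Finset M) : ℂ :=
  if hS : S.Nonempty then g (S.max' hS) S * pathWeight g (S.erase (S.max' hS)) else 1
termination_by S.card
decreasing_by exact Finset.card_erase_lt_of_mem (S.max'_mem hS)

/-- If the weights `g a S` of the edges `S → S \ {a}` of the cube of subsets have trivial
holonomy around every square, then all paths to `∅` have the same weight. -/
theorem pathWeight_eq {g : M → Finset M → ℂ}
    (hg : ∀ (S : Finset M) (a b : M), a ∈ S → b ∈ S → a ≠ b →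
      g a S * g b (S.erase a) = g b S * g a (S.erase b))
    (S : Finset M) {a : M} (ha : a ∈ S) :
    pathWeight g S = g a S * pathWeight g (S.erase a) := by
  induction S using Finset.strongInduction generalizing a with
  | H S ih =>
    have hS : S.Nonempty := ⟨a, ha⟩
    rw [pathWeight, dif_pos hS]
    set m := S.max' hS
    have hm : m ∈ S := S.max'_mem hS
    by_cases ham : a = m
    · rw [ham]
    · rw [ih (S.erase m) (Finset.erase_ssubset hm) (Finset.mem_erase.2 ⟨ham, ha⟩),
        ih (S.erase a) (Finset.erase_ssubset ha) (Finset.mem_erase.2 ⟨Ne.symm ham, hm⟩),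
        ← mul_assoc, ← mul_assoc, hg S a m ha hm ham, Finset.erase_right_comm]

theorem norm_pathWeight {g : M → Finset M → ℂ}
    (hg : ∀ (S : Finset M) (a : M), a ∈ S → ‖g a S‖ = 1) (S : Finset M) :
    ‖pathWeight g S‖ = 1 := by
  induction S using Finset.strongInduction with
  | H S ih =>
    rw [pathWeight]
    split_ifs with hS
    · rw [norm_mul, hg _ _ (S.max'_mem hS), ih _ (Finset.erase_ssubset (S.max'_mem hS)), one_mul]
    · exact norm_one

/-- A family of anticommuting matrices which map the basis vector of `S ∋ a` to a multiple of norm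
one of the basis vector of `S \ {a}` agrees with the annihilation operators up to a diagonal
unitary matrix. -/
theorem exists_eq_annihilation [Fintype M] (F : M → FockOp M)
    (hsupp : ∀ a T S, ¬(a ∈ S ∧ T = S.erase a) → F a T S = 0)
    (hnorm : ∀ a S, a ∈ S → ‖F a (S.erase a) S‖ = 1)
    (hanti : ∀ a b, F a * F b = -(F b * F a)) :
    ∃ η : Finset M → ℂ, (∀ S, ‖η S‖ = 1) ∧
      ∀ a T S, F a T S = η T * annihilation a T S * (starRingEnd ℂ) (η S) := by
  have hprod : ∀ G : M → FockOp M, (∀ a T S, ¬(a ∈ S ∧ T = S.erase a) → G a T S = 0) →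
      ∀ (S : Finset M) (a b : M), (G b * G a) ((S.erase a).erase b) S
        = G b ((S.erase a).erase b) (S.erase a) * G a (S.erase a) S := by
    intro G hG S a b
    rw [Matrix.mul_apply]
    refine Finset.sum_eq_single _ (fun U _ hU => ?_) (fun h => absurd (Finset.mem_univ _) h)
    rw [hG a U S (fun h => hU h.2), mul_zero]
  set g : M → Finset M → ℂ := fun a S => (starRingEnd ℂ) (F a (S.erase a) S * modeSign a S)
    with hgdef
  have hgnorm : ∀ (S : Finset M) (a : M), a ∈ S → ‖g a S‖ = 1 := fun S a ha => by
    simp [hgdef, hnorm a S ha, norm_modeSign]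
  have hg : ∀ (S : Finset M) (a b : M), a ∈ S → b ∈ S → a ≠ b →
      g a S * g b (S.erase a) = g b S * g a (S.erase b) := by
    intro S a b ha hb hab
    have h1 := congrFun (congrFun (hanti b a) ((S.erase a).erase b)) S
    have hann : ∀ a : M, annihilation a ((S.erase a)) S = if a ∈ S then modeSign a S else 0 :=
      fun a => by simp [annihilation_apply]
    have h2 := congrFun (congrFun (annihilation_mul_annihilation b a) ((S.erase a).erase b)) S
    rw [Matrix.neg_apply, hprod F hsupp] at h1
    rw [Matrix.neg_apply,
      hprod annihilation (fun a T S h => by rw [annihilation_apply, if_neg h])] at h2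
    rw [Finset.erase_right_comm, hprod F hsupp] at h1
    rw [Finset.erase_right_comm,
      hprod annihilation (fun a T S h => by rw [annihilation_apply, if_neg h])] at h2
    simp only [annihilation_apply, Finset.mem_erase, ha, hb, hab, Ne.symm hab, ne_eq,
      not_false_eq_true, and_true, if_true,
      Finset.erase_right_comm (a := b) (b := a)] at h2
    rw [Finset.erase_right_comm (a := b) (b := a)] at h1
    simp only [hgdef]
    rw [← map_mul, ← map_mul]
    congr 1
    rw [Finset.erase_right_comm (a := b) (b := a)]
    linear_combination (modeSign a S * modeSign b (S.erase a)) * h1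
      - (F a ((S.erase a).erase b) (S.erase b) * F b (S.erase b) S) * h2
  refine ⟨pathWeight g, norm_pathWeight hgnorm, fun a T S => ?_⟩
  by_cases h : a ∈ S ∧ T = S.erase a
  · obtain ⟨ha, rfl⟩ := h
    rw [annihilation_apply, if_pos ⟨ha, rfl⟩, pathWeight_eq hg S ha]
    have h1 : pathWeight g (S.erase a) * (starRingEnd ℂ) (pathWeight g (S.erase a)) = 1 := by
      rw [Complex.mul_conj, Complex.normSq_eq_norm_sq, norm_pathWeight hgnorm]; simp
    rw [map_mul, hgdef]
    simp only [Complex.conj_conj]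
    linear_combination (-(F a (S.erase a) S) * (modeSign a S * modeSign a S)) * h1
      - F a (S.erase a) S * modeSign_mul_self a S
  · rw [hsupp a T S h, annihilation_apply, if_neg h]; simp

end FlatSign

section UnitaryHom

variable {M k : Type} [LinearOrder M] [Fintype M] [Fintype k] [DecidableEq k]

/-- Conjugation with a diagonal unitary matrix, followed by a relabelling of the basis. -/
theorem exists_unitaryHom (E : Finset M ≃ k) {η : Finset M → ℂ} (hη : ∀ S, ‖η S‖ = 1) :
    ∃ Φ : FockOp M →ₐ[ℂ] Matrix k k ℂ,
      (∀ X A B, Φ X A B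
        = η (E.symm A) * X (E.symm A) (E.symm B) * (starRingEnd ℂ) (η (E.symm B))) ∧
      (∀ X, Φ Xᴴ = (Φ X)ᴴ) ∧
        ∀ X, (NormedSpace.exp (Φ X)).trace = (NormedSpace.exp X).trace := by
  have hηη : ∀ S, (starRingEnd ℂ) (η S) * η S = 1 := fun S => by
    rw [mul_comm, Complex.mul_conj, Complex.normSq_eq_norm_sq, hη]; simp
  let Φ : FockOp M →ₐ[ℂ] Matrix k k ℂ :=
    AlgHom.ofLinearMap
      { toFun := fun X => Matrix.of fun A B =>
          η (E.symm A) * X (E.symm A) (E.symm B) * (starRingEnd ℂ) (η (E.symm B))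
        map_add' := fun X Y => by ext A B; simp [mul_add, add_mul]
        map_smul' := fun r X => by ext A B; simp; ring }
      (by
        ext A B
        simp only [LinearMap.coe_mk, AddHom.coe_mk, Matrix.of_apply, Matrix.one_apply,
          EmbeddingLike.apply_eq_iff_eq]
        split_ifs with h
        · rw [h, mul_one, mul_comm, hηη]
        · simp)
      (fun X Y => by
        ext A B
        simp only [LinearMap.coe_mk, AddHom.coe_mk, Matrix.of_apply, Matrix.mul_apply,
          Finset.mul_sum, Finset.sum_mul]
        rw [← E.symm.sum_comp]
        refine Finset.sum_congr rfl fun C _ => ?_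
        linear_combination (-(η (E.symm A) * X (E.symm A) (E.symm C) * Y (E.symm C) (E.symm B)
          * (starRingEnd ℂ) (η (E.symm B)))) * hηη (E.symm C))
  have hΦ : ∀ X A B, Φ X A B
      = η (E.symm A) * X (E.symm A) (E.symm B) * (starRingEnd ℂ) (η (E.symm B)) :=
    fun _ _ _ => rfl
  refine ⟨Φ, hΦ, fun X => ?_, fun X => ?_⟩
  · ext A B
    rw [hΦ, Matrix.conjTranspose_apply, Matrix.conjTranspose_apply, hΦ]
    simp only [star_mul', RCLike.star_def, Complex.conj_conj]
    ring
  · have htr : ∀ X, (Φ X).trace = X.trace := fun X => by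
      simp only [Matrix.trace, Matrix.diag_apply, hΦ]
      rw [← E.symm.sum_comp (fun S => X S S)]
      refine Finset.sum_congr rfl fun A _ => ?_
      linear_combination X (E.symm A) (E.symm A) * hηη (E.symm A)
    rw [← htr (NormedSpace.exp X)]
    let _ : NormedRing (FockOp M) := Matrix.linftyOpNormedRing
    let _ : NormedAlgebra ℝ (FockOp M) := Matrix.linftyOpNormedAlgebra
    let _ : NormedAlgebra ℚ (FockOp M) := NormedAlgebra.restrictScalars ℚ ℝ _
    have _ : CompleteSpace (FockOp M) := FiniteDimensional.complete ℝ _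
    let _ : NormedRing (Matrix k k ℂ) :=
      Matrix.linftyOpNormedRing
    have hcont : Continuous Φ :=
      LinearMap.continuous_of_finiteDimensional (Φ.toLinearMap.restrictScalars ℝ)
    exact congrArg Matrix.trace (NormedSpace.map_exp Φ hcont X).symm

/-- The gauge transformation which multiplies each `ψ_a` by a phase. -/
theorem exists_gaugeHom {g : M → ℂ} (hg : ∀ a, ‖g a‖ = 1) :
    ∃ Φ : FockOp M →ₐ[ℂ] FockOp M,
      (∀ a, Φ (annihilation a) = g a • annihilation a) ∧ (∀ X, Φ Xᴴ = (Φ X)ᴴ) ∧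
        ∀ X, (NormedSpace.exp (Φ X)).trace = (NormedSpace.exp X).trace := by
  obtain ⟨η, hη, hF⟩ := exists_eq_annihilation (fun a => g a • annihilation a)
    (fun a T S h => by rw [Matrix.smul_apply, annihilation_apply, if_neg h, smul_zero])
    (fun a S h => by
      rw [Matrix.smul_apply, annihilation_apply, if_pos ⟨h, rfl⟩, norm_smul, hg, norm_modeSign,
        one_mul])
    (fun a b => by
      rw [smul_mul_smul_comm, smul_mul_smul_comm, annihilation_mul_annihilation, smul_neg,
        mul_comm])
  obtain ⟨Φ, hΦ, hstar, htr⟩ := exists_unitaryHom (Equiv.refl _) hη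
  refine ⟨Φ, fun a => ?_, hstar, htr⟩
  ext A B
  rw [hΦ, hF]
  rfl

end UnitaryHom

/-! ### Splitting the Fock space into two halves -/

section Splitting

variable {M Q : Type} [LinearOrder M] [Fintype M] [LinearOrder Q] [Fintype Q]

/-- The occupied modes of the left half, and the empty modes of the right half. -/
def splitModes (τ : Q ⊕ Q ≃ M) : Finset M ≃ Finset Q × Finset Q where
  toFun S := (Finset.univ.filter fun q => τ (Sum.inl q) ∈ S,
    Finset.univ.filter fun q => τ (Sum.inr q) ∉ S)
  invFun A := Finset.univ.filter fun a =>
    Sum.elim (fun q => decide (q ∈ A.1)) (fun q => decide (q ∉ A.2)) (τ.symm a)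
  left_inv S := by
    ext a
    obtain ⟨s, rfl⟩ := τ.surjective a
    rcases s with q | q <;> simp
  right_inv A := by
    ext q <;> simp

/-- The annihilation operators of both halves as operators on the doubled Fock space of the left
half. On the right half a particle-hole transformation is performed, and the parities make
operators of different halves anticommute and give the hopping terms between the halves the form
`C ⊗ conj C`. -/
def splitAnnihilation : Q ⊕ Q → Matrix (Finset Q × Finset Q) (Finset Q × Finset Q) ℂ :=
  Sum.elim (fun q => leftHom (annihilation q))
    (fun q => leftHom (parity Q) * rightHom (creation q * parity Q))

theorem splitAnnihilation_anticomm (s t : Q ⊕ Q) :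
    splitAnnihilation s * splitAnnihilation t = -(splitAnnihilation t * splitAnnihilation s) := by
  have hLR : ∀ q q' : Q, leftHom (annihilation q) * (leftHom (parity Q) * rightHom
      (creation q' * parity Q)) = -(leftHom (parity Q) * rightHom (creation q' * parity Q)
        * leftHom (annihilation q)) := fun q q' => by
    rw [mul_assoc (leftHom (parity Q)), rightHom_mul_leftHom, ← mul_assoc, ← mul_assoc, ← map_mul,
      ← map_mul, parity_mul_annihilation, map_neg, neg_mul, neg_neg]
  rcases s with q | q <;> rcases t with q' | q'
  · simp only [splitAnnihilation, Sum.elim_inl]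
    rw [← map_mul, annihilation_mul_annihilation, map_neg, map_mul]
  · exact hLR q q'
  · simp only [splitAnnihilation, Sum.elim_inl, Sum.elim_inr]
    rw [hLR, neg_neg]
  · simp only [splitAnnihilation, Sum.elim_inr]
    have h : ∀ q q' : Q, leftHom (parity Q) * rightHom (creation q * parity Q)
        * (leftHom (parity Q) * rightHom (creation q' * parity Q))
        = -rightHom (creation q * creation q') := fun q q' => by
      have h2 : creation q * parity Q * (creation q' * parity Q) = -(creation q * creation q') := by
        rw [mul_assoc, ← mul_assoc (parity Q) _ (parity Q), ← neg_eq_iff_eq_neg.2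
          (creation_mul_parity q'), neg_mul, mul_assoc (creation q'), parity_mul_parity, mul_one,
          mul_neg]
      rw [mul_assoc, ← mul_assoc (rightHom _) (leftHom _), rightHom_mul_leftHom, mul_assoc,
        ← map_mul, ← mul_assoc, ← map_mul, parity_mul_parity, map_one, one_mul, h2, map_neg]
    rw [h, h, creation_mul_creation, map_neg]

theorem splitAnnihilation_apply_inl (q : Q) (A B : Finset Q × Finset Q) :
    splitAnnihilation (Sum.inl q) A B =
      if q ∈ B.1 ∧ A = (B.1.erase q, B.2) then modeSign q B.1 else 0 := by
  simp only [splitAnnihilation, Sum.elim_inl, leftHom_apply, Matrix.kroneckerMap_apply,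
    annihilation_apply, Matrix.one_apply, Prod.ext_iff]
  split_ifs <;> simp_all

theorem splitAnnihilation_apply_inr (q : Q) (A B : Finset Q × Finset Q) :
    splitAnnihilation (Sum.inr q) A B =
      if q ∉ B.2 ∧ A = (B.1, insert q B.2) then
        (-1) ^ B.1.card * (modeSign q B.2 * (-1) ^ B.2.card) else 0 := by
  have hconj : (starRingEnd ℂ) (modeSign q B.2 * (-1) ^ B.2.card)
      = modeSign q B.2 * (-1) ^ B.2.card := by
    rw [map_mul, modeSign_conj]; simp
  simp only [splitAnnihilation, Sum.elim_inr, leftHom_mul_rightHom, Matrix.kroneckerMap_apply,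
    Matrix.map_apply, parity, Matrix.mul_diagonal, Matrix.diagonal_apply, creation_apply,
    Prod.ext_iff]
  by_cases h1 : A.1 = B.1 <;> by_cases h2 : q ∈ B.2 <;> by_cases h3 : A.2 = insert q B.2 <;>
    simp [h1, h2, h3, hconj]

theorem splitModes_erase_inl (τ : Q ⊕ Q ≃ M) (S : Finset M) (q : Q) :
    splitModes τ (S.erase (τ (Sum.inl q))) = ((splitModes τ S).1.erase q, (splitModes τ S).2) := by
  ext p <;> simp [splitModes]

theorem splitModes_erase_inr (τ : Q ⊕ Q ≃ M) (S : Finset M) (q : Q) :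
    splitModes τ (S.erase (τ (Sum.inr q))) = ((splitModes τ S).1, insert q (splitModes τ S).2) := by
  ext p <;> simp [splitModes]
  tauto

/-- The Fock space over the modes of two halves is the doubled Fock space over the modes of one
half, with the annihilation operators `splitAnnihilation`. -/
theorem exists_splitHom (τ : Q ⊕ Q ≃ M) :
    ∃ Φ : FockOp M →ₐ[ℂ] Matrix (Finset Q × Finset Q) (Finset Q × Finset Q) ℂ,
      (∀ s, Φ (annihilation (τ s)) = splitAnnihilation s) ∧ (∀ X, Φ Xᴴ = (Φ X)ᴴ) ∧
        ∀ X, (NormedSpace.exp (Φ X)).trace = (NormedSpace.exp X).trace := by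
  set E := splitModes τ with hE
  have hmem1 : ∀ (S : Finset M) q, q ∈ (E S).1 ↔ τ (Sum.inl q) ∈ S := fun S q => by
    simp [hE, splitModes]
  have hmem2 : ∀ (S : Finset M) q, q ∉ (E S).2 ↔ τ (Sum.inr q) ∈ S := fun S q => by
    simp [hE, splitModes]
  obtain ⟨η, hη, hF⟩ := exists_eq_annihilation
    (fun a => (splitAnnihilation (τ.symm a)).submatrix E E) (by
      intro a T S h
      obtain ⟨s, rfl⟩ := τ.surjective a
      rw [Matrix.submatrix_apply, Equiv.symm_apply_apply]
      rcases s with q | q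
      · rw [splitAnnihilation_apply_inl, if_neg]
        rintro ⟨h1, h2⟩
        rw [hE, ← splitModes_erase_inl] at h2
        exact h ⟨(hmem1 S q).1 h1, E.injective h2⟩
      · rw [splitAnnihilation_apply_inr, if_neg]
        rintro ⟨h1, h2⟩
        rw [hE, ← splitModes_erase_inr] at h2
        exact h ⟨(hmem2 S q).1 h1, E.injective h2⟩) (by
      intro a S ha
      obtain ⟨s, rfl⟩ := τ.surjective a
      rw [Matrix.submatrix_apply, Equiv.symm_apply_apply]
      rcases s with q | q
      · rw [splitAnnihilation_apply_inl, if_pos ⟨(hmem1 S q).2 ha, splitModes_erase_inl τ S q⟩,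
          norm_modeSign]
      · rw [splitAnnihilation_apply_inr, if_pos ⟨(hmem2 S q).2 ha, splitModes_erase_inr τ S q⟩,
          norm_mul, norm_mul, norm_modeSign]
        simp) (by
      intro a b
      rw [Matrix.submatrix_mul_equiv, Matrix.submatrix_mul_equiv, splitAnnihilation_anticomm]
      rfl)
  obtain ⟨Φ, hΦ, hstar, htr⟩ := exists_unitaryHom E hη
  refine ⟨Φ, fun s => ?_, hstar, htr⟩
  ext A B
  rw [hΦ, ← hF]
  simp

theorem splitAnnihilation_bilinear_inl_inl (q q' : Q) :
    (splitAnnihilation (Sum.inl q))ᴴ * splitAnnihilation (Sum.inl q')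
      = leftHom (creation q * annihilation q') := by
  simp only [splitAnnihilation, Sum.elim_inl]
  rw [← leftHom_conjTranspose, ← map_mul, creation]

theorem splitAnnihilation_inr_conjTranspose (q : Q) :
    (splitAnnihilation (Sum.inr q))ᴴ = leftHom (parity Q) * rightHom (parity Q * annihilation q) := by
  simp only [splitAnnihilation, Sum.elim_inr]
  rw [Matrix.conjTranspose_mul, ← leftHom_conjTranspose, ← rightHom_conjTranspose,
    rightHom_mul_leftHom, Matrix.conjTranspose_mul, parity_conjTranspose, creation,
    Matrix.conjTranspose_conjTranspose]

theorem splitAnnihilation_bilinear_inr_inr (q q' : Q) :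
    (splitAnnihilation (Sum.inr q))ᴴ * splitAnnihilation (Sum.inr q')
      = rightHom (annihilation q * creation q') := by
  have h : parity Q * annihilation q * (creation q' * parity Q) = annihilation q * creation q' := by
    rw [creation_mul_parity, parity_mul_annihilation, neg_mul_neg, mul_assoc, ← mul_assoc (parity Q),
      parity_mul_parity, one_mul]
  rw [splitAnnihilation_inr_conjTranspose]
  simp only [splitAnnihilation, Sum.elim_inr]
  rw [mul_assoc, ← mul_assoc (rightHom _) (leftHom _), rightHom_mul_leftHom, mul_assoc,
    ← map_mul, ← mul_assoc, ← map_mul, parity_mul_parity, map_one, one_mul, h]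

theorem splitAnnihilation_bilinear_inl_inr (q q' : Q) :
    (splitAnnihilation (Sum.inl q))ᴴ * splitAnnihilation (Sum.inr q')
      = leftHom (creation q * parity Q) * rightHom (creation q' * parity Q) := by
  simp only [splitAnnihilation, Sum.elim_inl, Sum.elim_inr]
  rw [← leftHom_conjTranspose, ← mul_assoc, ← map_mul]
  rfl

theorem splitAnnihilation_bilinear_inr_inl (q q' : Q) :
    (splitAnnihilation (Sum.inr q))ᴴ * splitAnnihilation (Sum.inl q')
      = leftHom (parity Q * annihilation q') * rightHom (parity Q * annihilation q) := by
  rw [splitAnnihilation_inr_conjTranspose]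
  simp only [splitAnnihilation, Sum.elim_inl]
  rw [mul_assoc, rightHom_mul_leftHom, ← mul_assoc, ← map_mul]

end Splitting

/-! ### Hamiltonians built from bilinears -/

section Hamiltonian

variable {Λ K A : Type} [Fintype Λ] [Fintype K] [Ring A] [Algebra ℂ A]

/-- The observable `∑ P_{στ} ψ*_{xσ} ψ_{xτ} - κ` at the site `x`, where `B x σ y τ` stands for
`ψ*_{xσ} ψ_{yτ}`. -/
noncomputable def siteObs (P : Matrix Spin Spin ℂ) (κ : ℝ) (B : Λ → Spin → Λ → Spin → A) (x : Λ) :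
    A :=
  ∑ σ, ∑ τ, P σ τ • B x σ x τ - (κ : ℂ) • 1

/-- The kinetic term with hopping amplitudes `h`. -/
def hopping (h : Λ → Λ → ℂ) (B : Λ → Spin → Λ → Spin → A) : A :=
  ∑ x, ∑ y, ∑ σ, h x y • B x σ y σ

/-- The on-site interaction. -/
noncomputable def onSite (B : Λ → Spin → Λ → Spin → A) : A :=
  ∑ x, (B x 0 x 0 - (1 / 2 : ℂ) • 1) * (B x 1 x 1 - (1 / 2 : ℂ) • 1)

open Classical in
/-- The interaction of the observables `siteObs P κ` at adjacent sites. -/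
noncomputable def pairInteraction (adj : Λ → Λ → Prop) (P : Matrix Spin Spin ℂ) (κ : ℝ)
    (B : Λ → Spin → Λ → Spin → A) : A :=
  ∑ x, ∑ y, if adj x y then siteObs P κ B x * siteObs P κ B y else 0

/-- The coupling constants of a Hubbard type model: the adjacency relation of the sites, the on-site
coupling, and a family of Hermitian one-site observables `∑ P_{στ} ψ*_{xσ} ψ_{xτ} - κ` which are odd
under the particle-hole transformation, each with the strength of its interaction. -/
structure Couplings (Λ K : Type) where
  adj : Λ → Λ → Prop
  onsite : ℝ
  strength : K → ℝ
  mat : K → Matrix Spin Spin ℂ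
  shift : K → ℝ
  strength_nonneg : ∀ k, 0 ≤ strength k
  mat_hermitian : ∀ k, (mat k).IsHermitian
  trace_mat : ∀ k, (mat k).trace = 2 * shift k

/-- The Hamiltonian with hopping amplitudes `h` and couplings `c`. -/
noncomputable def hubbard (c : Couplings Λ K) (h : Λ → Λ → ℂ) (B : Λ → Spin → Λ → Spin → A) : A :=
  hopping h B + (c.onsite : ℂ) • onSite B
    + ∑ k, (c.strength k : ℂ) • pairInteraction c.adj (c.mat k) (c.shift k) B

theorem map_hubbard {A' : Type} [Ring A'] [Algebra ℂ A'] (Φ : A →ₐ[ℂ] A') (c : Couplings Λ K)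
    (h : Λ → Λ → ℂ) (B : Λ → Spin → Λ → Spin → A) :
    Φ (hubbard c h B) = hubbard c h (fun x σ y τ => Φ (B x σ y τ)) := by
  simp only [hubbard, hopping, onSite, pairInteraction, siteObs, map_add, map_sum, map_smul,
    map_mul, map_sub, map_one, map_zero, apply_ite Φ]

/-- Transport of couplings along a bijection of the sites. -/
def Couplings.comap {Λ' : Type} (e : Λ' ≃ Λ) (c : Couplings Λ K) : Couplings Λ' K :=
  { c with adj := fun x y => c.adj (e x) (e y) }

theorem hubbard_comap {Λ' : Type} [Fintype Λ'] (e : Λ' ≃ Λ) (c : Couplings Λ K)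
    (h : Λ → Λ → ℂ) (B : Λ → Spin → Λ → Spin → A) :
    hubbard (c.comap e) (fun x y => h (e x) (e y)) (fun x σ y τ => B (e x) σ (e y) τ)
      = hubbard c h B := by
  have e1 : ∀ f : Λ → A, ∑ x, f (e x) = ∑ x, f x := fun f => e.sum_comp f
  unfold hubbard hopping onSite pairInteraction
  rw [← e1 (fun x => ∑ y, ∑ σ, h x y • B x σ y σ), ← e1 (fun x => (B x 0 x 0 - (1 / 2 : ℂ) • 1) *
    (B x 1 x 1 - (1 / 2 : ℂ) • 1))]
  congr 1
  · congr 1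
    exact Finset.sum_congr rfl fun x _ => e1 (fun y => ∑ σ, h (e x) y • B (e x) σ y σ)
  · refine Finset.sum_congr rfl fun k _ => ?_
    simp only [Couplings.comap]
    congr 1
    classical
    rw [← e1]
    refine Finset.sum_congr rfl fun x _ => ?_
    rw [← e1]
    rfl

end Hamiltonian

/-! ### The Hamiltonian is Hermitian -/

section Hermitian

variable {Λ K n : Type} [Fintype n] [DecidableEq n]

theorem siteObs_isHermitian {P : Matrix Spin Spin ℂ} (hP : P.IsHermitian) (κ : ℝ)
    {B : Λ → Spin → Λ → Spin → Matrix n n ℂ}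
    (hB : ∀ x σ y τ, (B x σ y τ)ᴴ = B y τ x σ) (x : Λ) : (siteObs P κ B x).IsHermitian := by
  rw [Matrix.IsHermitian, siteObs, Matrix.conjTranspose_sub, Matrix.conjTranspose_sum,
    Finset.sum_comm]
  congr 1
  · refine Finset.sum_congr rfl fun σ _ => ?_
    rw [Matrix.conjTranspose_sum]
    refine Finset.sum_congr rfl fun τ _ => ?_
    rw [Matrix.conjTranspose_smul, hB, hP.apply]
  · rw [Matrix.conjTranspose_smul]; simp

variable [Fintype Λ] [Fintype K]

theorem hubbard_isHermitian (c : Couplings Λ K) (hadj : ∀ x y, c.adj x y → c.adj y x)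
    {h : Λ → Λ → ℂ} (hh : ∀ x y, (starRingEnd ℂ) (h x y) = h y x)
    {B : Λ → Spin → Λ → Spin → Matrix n n ℂ} (hB : ∀ x σ y τ, (B x σ y τ)ᴴ = B y τ x σ)
    (hcomm : ∀ x, B x 0 x 0 * B x 1 x 1 = B x 1 x 1 * B x 0 x 0) :
    (hubbard c h B).IsHermitian := by
  classical
  refine (Matrix.IsHermitian.add ?_ ?_).add ?_
  · rw [Matrix.IsHermitian, hopping, Matrix.conjTranspose_sum, Finset.sum_comm]
    refine Finset.sum_congr rfl fun x _ => ?_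
    rw [Matrix.conjTranspose_sum]
    refine Finset.sum_congr rfl fun y _ => ?_
    rw [Matrix.conjTranspose_sum]
    refine Finset.sum_congr rfl fun σ _ => ?_
    rw [Matrix.conjTranspose_smul, hB]
    congr 1
    exact hh _ _
  · rw [Matrix.IsHermitian, Matrix.conjTranspose_smul, onSite, Matrix.conjTranspose_sum]
    congr 1
    · simp
    refine Finset.sum_congr rfl fun x _ => ?_
    simp only [Matrix.conjTranspose_mul, Matrix.conjTranspose_sub, Matrix.conjTranspose_smul, hB,
      Matrix.conjTranspose_one]
    simp only [mul_sub, sub_mul, hcomm x, Matrix.smul_mul, Matrix.mul_smul, mul_one, one_mul]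
    simp
    abel
  · rw [Matrix.IsHermitian, Matrix.conjTranspose_sum]
    refine Finset.sum_congr rfl fun k _ => ?_
    rw [Matrix.conjTranspose_smul, pairInteraction, Matrix.conjTranspose_sum, Finset.sum_comm]
    congr 1
    · simp
    refine Finset.sum_congr rfl fun x _ => ?_
    rw [Matrix.conjTranspose_sum]
    refine Finset.sum_congr rfl fun y _ => ?_
    have hxy : c.adj x y ↔ c.adj y x := ⟨hadj x y, hadj y x⟩
    by_cases h1 : c.adj x y
    · rw [if_pos h1, if_pos (hxy.1 h1), Matrix.conjTranspose_mul,
        (siteObs_isHermitian (c.mat_hermitian k) _ hB x).eq,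
        (siteObs_isHermitian (c.mat_hermitian k) _ hB y).eq]
    · rw [if_neg h1, if_neg (fun h2 => h1 (hxy.2 h2)), Matrix.conjTranspose_zero]

end Hermitian

/-! ### Reflection of the Hamiltonian -/

section Reflection

variable {Λ K n : Type} [DecidableEq Λ] [Fintype n] [DecidableEq n]

/-- Hopping amplitudes on the doubled lattice: `hl` on the left half, `-hr` on the right half, and
`-w x` between `x` and its mirror image. -/
def glue (w : Λ → ℝ) (hl hr : Λ → Λ → ℂ) : Λ ⊕ Λ → Λ ⊕ Λ → ℂ
  | Sum.inl x, Sum.inl y => hl x y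
  | Sum.inr x, Sum.inr y => -hr x y
  | Sum.inl x, Sum.inr y => if x = y then -(w x : ℂ) else 0
  | Sum.inr x, Sum.inl y => if x = y then -(w x : ℂ) else 0

/-- The couplings on the doubled lattice: those of `c` on both halves, and `x` is adjacent to its
mirror image if `e x` holds. -/
def Couplings.double (c : Couplings Λ K) (e : Λ → Prop) : Couplings (Λ ⊕ Λ) K :=
  { c with
    adj := fun
      | Sum.inl x, Sum.inl y => c.adj x y
      | Sum.inr x, Sum.inr y => c.adj x y
      | Sum.inl x, Sum.inr y => x = y ∧ e x
      | Sum.inr x, Sum.inl y => x = y ∧ e x }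

/-- The bilinears on the doubled lattice are obtained from bilinears `b` on the left half: on the
right half by complex conjugation and a particle-hole transformation, and between the halves as
`C ⊗ conj C`. -/
structure IsDoubled (b : Λ → Spin → Λ → Spin → Matrix n n ℂ) (C C' : Λ → Spin → Matrix n n ℂ)
    (B : Λ ⊕ Λ → Spin → Λ ⊕ Λ → Spin → Matrix (n × n) (n × n) ℂ) : Prop where
  left : ∀ x σ y τ, B (Sum.inl x) σ (Sum.inl y) τ = leftHom (b x σ y τ)
  right : ∀ x σ y τ, B (Sum.inr x) σ (Sum.inr y) τ
    = rightHom ((if x = y ∧ σ = τ then 1 else 0) - b y τ x σ)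
  cross : ∀ x σ y τ, B (Sum.inl x) σ (Sum.inr y) τ = leftHom (C x σ) * rightHom (C y τ)
  cross' : ∀ x σ y τ, B (Sum.inr x) σ (Sum.inl y) τ = leftHom (C' y τ) * rightHom (C' x σ)

variable {b : Λ → Spin → Λ → Spin → Matrix n n ℂ} {C C' : Λ → Spin → Matrix n n ℂ}
  {B : Λ ⊕ Λ → Spin → Λ ⊕ Λ → Spin → Matrix (n × n) (n × n) ℂ}

theorem IsDoubled.siteObs_inl (hB : IsDoubled b C C' B) (P : Matrix Spin Spin ℂ) (κ : ℝ) (x : Λ) :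
    siteObs P κ B (Sum.inl x) = leftHom (siteObs P κ b x) := by
  simp only [siteObs, map_sub, map_sum, map_smul, map_one, hB.left]

/-- The observables are odd under the combination of reflection, complex conjugation and
particle-hole transformation. -/
theorem IsDoubled.siteObs_inr (hB : IsDoubled b C C' B) {P : Matrix Spin Spin ℂ}
    (hP : P.IsHermitian) {κ : ℝ} (hκ : P.trace = 2 * κ) (x : Λ) :
    siteObs P κ B (Sum.inr x) = -rightHom (siteObs P κ b x) := by
  have h1 : rightHom (∑ σ, ∑ τ, P σ τ • b x σ x τ)
      = ∑ σ, ∑ τ, P σ τ • rightHom (b x τ x σ) := by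
    simp only [map_sum, rightHom_smul]
    rw [Finset.sum_comm]
    refine Finset.sum_congr rfl fun σ _ => Finset.sum_congr rfl fun τ _ => ?_
    congr 1
    exact hP.apply σ τ
  have h2 : ∑ σ, ∑ τ, P σ τ • B (Sum.inr x) σ (Sum.inr x) τ
      = P.trace • (1 : Matrix (n × n) (n × n) ℂ) - ∑ σ, ∑ τ, P σ τ • rightHom (b x τ x σ) := by
    rw [Matrix.trace, Finset.sum_smul, ← Finset.sum_sub_distrib]
    refine Finset.sum_congr rfl fun σ _ => ?_
    simp only [hB.right, true_and, map_sub, smul_sub, Finset.sum_sub_distrib]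
    congr 1
    rw [Finset.sum_eq_single σ (fun τ _ hτ => by simp [Ne.symm hτ]) (by simp)]
    simp
  rw [siteObs, siteObs, map_sub, h1, h2, hκ, rightHom_smul, map_one, Complex.conj_ofReal,
    two_mul, add_smul]
  abel

variable [Fintype Λ]

theorem IsDoubled.hopping (hB : IsDoubled b C C' B) (w : Λ → ℝ) (hl : Λ → Λ → ℂ)
    {hr : Λ → Λ → ℂ} (hh : ∀ x y, (starRingEnd ℂ) (hr x y) = hr y x) (h0 : ∀ x, hr x x = 0) :
    hopping (glue w hl hr) B = leftHom (hopping hl b) + rightHom (hopping hr b)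
      - ∑ x, ∑ σ, (w x : ℂ) • (leftHom (C x σ) * rightHom (C x σ)
        + leftHom (C' x σ) * rightHom (C' x σ)) := by
  have hR : ∑ x, ∑ y, ∑ σ, glue w hl hr (Sum.inr x) (Sum.inr y) • B (Sum.inr x) σ (Sum.inr y) σ
      = rightHom (FluxPhase.hopping hr b) := by
    simp only [FluxPhase.hopping, map_sum, rightHom_smul, hh]
    rw [Finset.sum_comm]
    refine Finset.sum_congr rfl fun x _ => Finset.sum_congr rfl fun y _ =>
      Finset.sum_congr rfl fun σ _ => ?_
    rw [hB.right, glue]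
    by_cases hxy : y = x
    · rw [hxy, h0]; simp
    · simp [hxy]
  have hL : ∑ x, ∑ y, ∑ σ, glue w hl hr (Sum.inl x) (Sum.inl y) • B (Sum.inl x) σ (Sum.inl y) σ
      = leftHom (FluxPhase.hopping hl b) := by
    simp only [FluxPhase.hopping, map_sum, map_smul, hB.left, glue]
  have hC : ∑ x, ∑ y, ∑ σ, glue w hl hr (Sum.inl x) (Sum.inr y) • B (Sum.inl x) σ (Sum.inr y) σ
      = -∑ x, ∑ σ, (w x : ℂ) • (leftHom (C x σ) * rightHom (C x σ)) := by
    rw [← Finset.sum_neg_distrib]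
    refine Finset.sum_congr rfl fun x _ => ?_
    rw [Finset.sum_eq_single x (fun y _ hy => by simp [glue, Ne.symm hy]) (by simp),
      ← Finset.sum_neg_distrib]
    simp [glue, hB.cross]
  have hC' : ∑ x, ∑ y, ∑ σ, glue w hl hr (Sum.inr x) (Sum.inl y) • B (Sum.inr x) σ (Sum.inl y) σ
      = -∑ x, ∑ σ, (w x : ℂ) • (leftHom (C' x σ) * rightHom (C' x σ)) := by
    rw [← Finset.sum_neg_distrib]
    refine Finset.sum_congr rfl fun x _ => ?_
    rw [Finset.sum_eq_single x (fun y _ hy => by simp [glue, Ne.symm hy]) (by simp),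
      ← Finset.sum_neg_distrib]
    simp [glue, hB.cross']
  rw [FluxPhase.hopping]
  simp only [Fintype.sum_sum_type, Finset.sum_add_distrib, hL, hR, hC, hC', smul_add]
  abel

theorem IsDoubled.onSite (hB : IsDoubled b C C' B) :
    onSite B = leftHom (onSite b) + rightHom (onSite b) := by
  have hr : ∀ x σ, B (Sum.inr x) σ (Sum.inr x) σ - (1 / 2 : ℂ) • 1
      = -rightHom (b x σ x σ - (1 / 2 : ℂ) • 1) := fun x σ => by
    have h2 : (starRingEnd ℂ) (1 / 2 : ℂ) = 1 / 2 := by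
      rw [map_div₀, map_one, map_ofNat]
    rw [hB.right, if_pos ⟨rfl, rfl⟩, map_sub, map_sub, map_one, rightHom_smul, map_one, h2]
    have : (1 : Matrix (n × n) (n × n) ℂ) = (1 / 2 : ℂ) • 1 + (1 / 2 : ℂ) • 1 := by
      rw [← add_smul]; norm_num
    nth_rewrite 1 [this]
    abel
  rw [FluxPhase.onSite, FluxPhase.onSite, Fintype.sum_sum_type, map_sum, map_sum]
  congr 1
  · refine Finset.sum_congr rfl fun x _ => ?_
    simp only [hB.left, map_mul, map_sub, map_smul, map_one]
  · refine Finset.sum_congr rfl fun x _ => ?_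
    rw [hr, hr, neg_mul_neg, map_mul]

theorem IsDoubled.pairInteraction (hB : IsDoubled b C C' B) (c : Couplings Λ K) (e : Λ → Prop)
    (k : K) :
    open Classical in
    pairInteraction (c.double e).adj (c.mat k) (c.shift k) B
      = leftHom (pairInteraction c.adj (c.mat k) (c.shift k) b)
        + rightHom (pairInteraction c.adj (c.mat k) (c.shift k) b)
        - ∑ x, if e x then (2 : ℂ) • (leftHom (siteObs (c.mat k) (c.shift k) b x)
            * rightHom (siteObs (c.mat k) (c.shift k) b x)) else 0 := by
  classical
  have hl := hB.siteObs_inl (c.mat k) (c.shift k)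
  have hr := hB.siteObs_inr (c.mat_hermitian k) (c.trace_mat k)
  simp only [FluxPhase.pairInteraction, Fintype.sum_sum_type, hl, hr, Couplings.double, map_sum,
    apply_ite leftHom, apply_ite rightHom, map_mul, map_zero, mul_neg, neg_mul,
    rightHom_mul_leftHom, Finset.sum_add_distrib]
  have h1 : ∀ x, ∑ y, (if x = y ∧ e x then -(leftHom (siteObs (c.mat k) (c.shift k) b x)
      * rightHom (siteObs (c.mat k) (c.shift k) b y)) else 0)
      = -if e x then leftHom (siteObs (c.mat k) (c.shift k) b x)
        * rightHom (siteObs (c.mat k) (c.shift k) b x) else 0 := fun x => by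
    rw [Finset.sum_eq_single x (fun y _ hy => by simp [Ne.symm hy]) (by simp)]
    by_cases he : e x <;> simp [he]
  have h2 : ∀ x, ∑ y, (if x = y ∧ e x then -(leftHom (siteObs (c.mat k) (c.shift k) b y)
      * rightHom (siteObs (c.mat k) (c.shift k) b x)) else 0)
      = -if e x then leftHom (siteObs (c.mat k) (c.shift k) b x)
        * rightHom (siteObs (c.mat k) (c.shift k) b x) else 0 := fun x => by
    rw [Finset.sum_eq_single x (fun y _ hy => by simp [Ne.symm hy]) (by simp)]
    by_cases he : e x <;> simp [he]
  have h3 : ∀ x, (if e x then (2 : ℂ) • (leftHom (siteObs (c.mat k) (c.shift k) b x)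
      * rightHom (siteObs (c.mat k) (c.shift k) b x)) else 0)
      = (if e x then leftHom (siteObs (c.mat k) (c.shift k) b x)
        * rightHom (siteObs (c.mat k) (c.shift k) b x) else 0)
      + if e x then leftHom (siteObs (c.mat k) (c.shift k) b x)
        * rightHom (siteObs (c.mat k) (c.shift k) b x) else 0 := fun x => by
    by_cases he : e x <;> simp [he, two_smul]
  simp only [h1, h2, h3, Finset.sum_neg_distrib, Finset.sum_add_distrib]
  abel_nf

variable [Fintype K]

/-- The Hamiltonian of the doubled lattice has the form to which reflection positivity applies. -/
theorem IsDoubled.exists_hubbard (hB : IsDoubled b C C' B) (c : Couplings Λ K) (e : Λ → Prop)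
    {β : ℝ} (hβ : 0 ≤ β) {w : Λ → ℝ} (hw : ∀ x, 0 ≤ w x) :
    ∃ (ι : Type) (_ : Fintype ι) (X : ι → Matrix n n ℂ), ∀ hl hr : Λ → Λ → ℂ,
      (∀ x y, (starRingEnd ℂ) (hr x y) = hr y x) → (∀ x, hr x x = 0) →
      (-β : ℂ) • hubbard (c.double e) (glue w hl hr) B
        = leftHom ((-β : ℂ) • hubbard c hl b) + rightHom ((-β : ℂ) • hubbard c hr b)
          + ∑ i, leftHom (X i) * rightHom (X i) := by
  classical
  have hsq : ∀ (r : ℝ), 0 ≤ r → ∀ Y : Matrix n n ℂ,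
      leftHom ((√r : ℂ) • Y) * rightHom ((√r : ℂ) • Y) = (r : ℂ) • (leftHom Y * rightHom Y) := by
    intro r hr Y
    rw [map_smul, rightHom_smul, smul_mul_smul_comm, Complex.conj_ofReal, ← Complex.ofReal_mul,
      Real.mul_self_sqrt hr]
  -- the square roots absorb the nonnegative coefficients of `C ⊗ conj C`; the factor `2` arises
  -- since the interaction sums over ordered pairs of sites
  refine ⟨(Λ × Spin) ⊕ (Λ × Spin) ⊕ (K × Λ), inferInstance,
    Sum.elim (fun i => (√(β * w i.1) : ℂ) • C i.1 i.2)
      (Sum.elim (fun i => (√(β * w i.1) : ℂ) • C' i.1 i.2)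
        (fun i => (√(if e i.2 then 2 * (β * c.strength i.1) else 0) : ℂ) •
          siteObs (c.mat i.1) (c.shift i.1) b i.2)), fun hl hr hh h0 => ?_⟩
  have h1 : ∀ k x, 0 ≤ if e x then 2 * (β * c.strength k) else 0 := fun k x => by
    have := c.strength_nonneg k
    split_ifs <;> positivity
  have h2 : ∀ x, 0 ≤ β * w x := fun x => mul_nonneg hβ (hw x)
  simp only [Fintype.sum_sum_type, Sum.elim_inl, Sum.elim_inr, hsq _ (h2 _), hsq _ (h1 _ _),
    Fintype.sum_prod_type]
  have hconj : (starRingEnd ℂ) (-β : ℂ) = -β := by simp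
  have h3 : ∀ (k : K) (x : Λ), (((if e x then 2 * (β * c.strength k) else 0 : ℝ)) : ℂ) •
      (leftHom (siteObs (c.mat k) (c.shift k) b x) * rightHom (siteObs (c.mat k) (c.shift k) b x))
      = (β : ℂ) • (c.strength k : ℂ) • (if e x then (2 : ℂ) •
        (leftHom (siteObs (c.mat k) (c.shift k) b x)
          * rightHom (siteObs (c.mat k) (c.shift k) b x)) else 0) := fun k x => by
    by_cases he : e x
    · simp only [he, if_true, smul_smul]; congr 1; push_cast; ring
    · simp [he]
  simp only [h3, hubbard, hB.hopping w hl hh h0, hB.onSite]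
  have hdd : (c.double e).mat = c.mat ∧ (c.double e).shift = c.shift
    ∧ (c.double e).strength = c.strength ∧ (c.double e).onsite = c.onsite := ⟨rfl, rfl, rfl, rfl⟩
  simp only [hdd, hB.pairInteraction c e, rightHom_smul, map_smul, map_add, map_sum, smul_sub,
    smul_add, Finset.smul_sum, Finset.sum_add_distrib, Finset.sum_sub_distrib, map_neg,
    Complex.conj_ofReal, Complex.ofReal_mul, neg_smul, mul_smul]
  simp only [smul_ite, smul_zero, Finset.sum_neg_distrib, ← Finset.smul_sum]
  abel

end Reflection

/-! ### Reflection positivity -/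

section ReflectionPositivity

variable {Λ K M : Type} [Fintype M] [LinearOrder M]

/-- The bilinears `ψ*_{xσ} ψ_{yτ}` for the labelling `m` of the modes. -/
def bilinear (m : Λ × Spin → M) (x : Λ) (σ : Spin) (y : Λ) (τ : Spin) : FockOp M :=
  creation (m (x, σ)) * annihilation (m (y, τ))

theorem bilinear_conjTranspose (m : Λ × Spin → M) (x : Λ) (σ : Spin) (y : Λ) (τ : Spin) :
    (bilinear m x σ y τ)ᴴ = bilinear m y τ x σ := by
  rw [bilinear, Matrix.conjTranspose_mul, creation, Matrix.conjTranspose_conjTranspose]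
  rfl

theorem creation_mul_annihilation_self (a : M) :
    creation a * annihilation a = Matrix.diagonal fun S => if a ∈ S then 1 else 0 := by
  ext T S
  rw [mul_annihilation_apply, Matrix.diagonal_apply]
  by_cases ha : a ∈ S
  · simp only [ha, if_true, creation_apply, Finset.mem_erase, ne_eq, not_true_eq_false, false_and,
      not_false_eq_true, true_and, Finset.insert_erase, modeSign_erase_self, ite_mul, zero_mul,
      modeSign_mul_self]
    by_cases hT : T = S
    · simp [hT, ha]
    · simp [hT]
  · by_cases hT : T = S
    · simp [hT, ha]
    · simp [hT, ha]

variable [Fintype Λ] [Fintype K]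

/-- The partition function with hopping amplitudes `h`. -/
noncomputable def partition (c : Couplings Λ K) (β : ℝ) (m : Λ × Spin → M) (h : Λ → Λ → ℂ) : ℂ :=
  (NormedSpace.exp ((-β : ℂ) • hubbard c h (bilinear m))).trace

theorem isHermitian_hubbard (c : Couplings Λ K) (hadj : ∀ x y, c.adj x y → c.adj y x)
    (m : Λ × Spin → M) {h : Λ → Λ → ℂ} (hh : ∀ x y, (starRingEnd ℂ) (h x y) = h y x) :
    (hubbard c h (bilinear m)).IsHermitian := by
  refine hubbard_isHermitian c hadj hh (bilinear_conjTranspose m) fun x => ?_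
  rw [bilinear, bilinear, creation_mul_annihilation_self, creation_mul_annihilation_self,
    Matrix.diagonal_mul_diagonal, Matrix.diagonal_mul_diagonal]
  simp only [mul_comm]

theorem partition_pos (c : Couplings Λ K) (hadj : ∀ x y, c.adj x y → c.adj y x) (β : ℝ)
    (m : Λ × Spin → M) {h : Λ → Λ → ℂ} (hh : ∀ x y, (starRingEnd ℂ) (h x y) = h y x) :
    (partition c β m h).im = 0 ∧ 0 < (partition c β m h).re := by
  refine trace_exp_pos ?_
  rw [Matrix.IsHermitian, Matrix.conjTranspose_smul, (isHermitian_hubbard c hadj m hh).eq]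
  simp

/-- Reflection positivity of the partition function on a doubled lattice. -/
theorem norm_partition_sq_le [DecidableEq Λ] (c : Couplings Λ K) (e : Λ → Prop) {β : ℝ}
    (hβ : 0 ≤ β) (m : (Λ ⊕ Λ) × Spin ≃ M) {w : Λ → ℝ} (hw : ∀ x, 0 ≤ w x) {hl hr : Λ → Λ → ℂ}
    (hhl : ∀ x y, (starRingEnd ℂ) (hl x y) = hl y x) (hl0 : ∀ x, hl x x = 0)
    (hhr : ∀ x y, (starRingEnd ℂ) (hr x y) = hr y x) (hr0 : ∀ x, hr x x = 0) :
    ‖partition (c.double e) β m (glue w hl hr)‖ ^ 2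
      ≤ (partition (c.double e) β m (glue w hl hl)).re
        * (partition (c.double e) β m (glue w hr hr)).re := by
  let q : Λ × Spin ≃ Fin (Fintype.card (Λ × Spin)) := Fintype.equivFin _
  let τ : Fin (Fintype.card (Λ × Spin)) ⊕ Fin (Fintype.card (Λ × Spin)) ≃ M :=
    (Equiv.sumCongr q.symm q.symm).trans ((Equiv.sumProdDistrib Λ Λ Spin).symm.trans m)
  have hτl : ∀ x σ, m (Sum.inl x, σ) = τ (Sum.inl (q (x, σ))) := fun x σ => by simp [τ]
  have hτr : ∀ x σ, m (Sum.inr x, σ) = τ (Sum.inr (q (x, σ))) := fun x σ => by simp [τ]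
  obtain ⟨Φ, hΦ, hΦstar, hΦtr⟩ := exists_splitHom τ
  have hΦ2 : ∀ s t, Φ (creation (τ s) * annihilation (τ t))
      = (splitAnnihilation s)ᴴ * splitAnnihilation t := fun s t => by
    rw [map_mul, creation, hΦstar, hΦ, hΦ]
  have hB : IsDoubled (fun x σ y τ => creation (q (x, σ)) * annihilation (q (y, τ)))
      (fun x σ => creation (q (x, σ)) * parity _) (fun x σ => parity _ * annihilation (q (x, σ)))
      (fun x σ y τ => Φ (bilinear m x σ y τ)) := by
    constructor
    · intro x σ y τ'
      rw [bilinear, hτl, hτl, hΦ2, splitAnnihilation_bilinear_inl_inl]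
    · intro x σ y τ'
      rw [bilinear, hτr, hτr, hΦ2, splitAnnihilation_bilinear_inr_inr, annihilation_mul_creation]
      simp only [EmbeddingLike.apply_eq_iff_eq, Prod.mk.injEq]
    · intro x σ y τ'
      rw [bilinear, hτl, hτr, hΦ2, splitAnnihilation_bilinear_inl_inr]
    · intro x σ y τ'
      rw [bilinear, hτr, hτl, hΦ2, splitAnnihilation_bilinear_inr_inl]
  obtain ⟨ι, _, X, hX⟩ := hB.exists_hubbard c e hβ hw
  have hZ : ∀ h, partition (c.double e) β m h = (NormedSpace.exp ((-β : ℂ) •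
      hubbard (c.double e) h (fun x σ y τ => Φ (bilinear m x σ y τ)))).trace := fun h => by
    rw [partition, ← hΦtr, map_smul, map_hubbard]
  rw [hZ, hZ, hZ, hX _ _ hhr hr0, hX _ _ hhl hl0, hX _ _ hhr hr0]
  exact norm_trace_exp_sq_le _ _ _

end ReflectionPositivity

/-! ### Reflections of the discrete torus -/

/-- The discrete torus `(ℤ / 2Lℤ)^d`. -/
abbrev Torus (d L : ℕ) : Type := Fin d → ZMod (2 * L)

/-- `x` and `y` are neighbours in direction `j`. -/
def Bond {d L : ℕ} (j : Fin d) (x y : Torus d L) : Prop :=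
  x - y = Pi.single j 1 ∨ x - y = -Pi.single j 1

/-- `x` lies in the half of the torus which consists of the layers `p, …, p + L - 1` orthogonal to
the direction `j`. -/
def InHalf {d L : ℕ} (j : Fin d) (p : ZMod (2 * L)) (x : Torus d L) : Prop := (x j - p).val < L

/-- The reflection which exchanges the layers `p` and `p - 1` orthogonal to the direction `j`, and
thus also the layers `p + L - 1` and `p + L`. -/
def refl {d L : ℕ} (j : Fin d) (p : ZMod (2 * L)) (x : Torus d L) : Torus d L :=
  Function.update x j (2 * p - 1 - x j)

section Geometry

variable {d L : ℕ} {j k : Fin d} {p : ZMod (2 * L)} {x y z w : Torus d L}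

theorem bond_comm : Bond k x y ↔ Bond k y x := by
  unfold Bond
  rw [← neg_sub y x, neg_inj, neg_eq_iff_eq_neg, or_comm]

theorem bond_apply_ne (h : Bond k x y) {l : Fin d} (hl : l ≠ k) : x l = y l := by
  rw [← sub_eq_zero, ← Pi.sub_apply]
  rcases h with h | h <;> rw [h] <;> simp [hl]

theorem bond_apply_same (h : Bond k x y) : x k - y k = 1 ∨ x k - y k = -1 := by
  rw [← Pi.sub_apply]
  rcases h with h | h
  · left; rw [h]; simp
  · right; rw [h]; simp

theorem bond_of_apply (h : x k - y k = 1 ∨ x k - y k = -1) (h2 : ∀ l, l ≠ k → x l = y l) :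
    Bond k x y := by
  rcases h with h | h
  · left
    ext l
    by_cases hl : l = k
    · subst hl; simp [h]
    · simp [hl, h2 l hl]
  · right
    ext l
    by_cases hl : l = k
    · subst hl; simp [h]
    · simp [hl, h2 l hl]

theorem bond_of_sub_eq {k : Fin d} {x y z w : Torus d L} (h : Bond k x y) (h2 : z - w = x - y) :
    Bond k z w := by
  rwa [Bond, h2]

theorem refl_apply_same : refl j p x j = 2 * p - 1 - x j := by simp [refl]

theorem refl_apply_ne {l : Fin d} (hl : l ≠ j) : refl j p x l = x l := by simp [refl, hl]

theorem refl_refl : refl j p (refl j p x) = x := by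
  simp [refl]

theorem bond_refl : Bond k (refl j p x) (refl j p y) ↔ Bond k x y := by
  suffices h : ∀ x y : Torus d L, Bond k x y → Bond k (refl j p x) (refl j p y) by
    refine ⟨fun h1 => ?_, h x y⟩
    have := h _ _ h1
    rwa [refl_refl, refl_refl] at this
  intro x y h
  refine bond_of_apply ?_ fun l hl => ?_
  · by_cases hk : k = j
    · subst hk
      rw [refl_apply_same, refl_apply_same, or_comm]
      convert bond_apply_same h using 1
      · rw [← neg_inj (b := (1 : ZMod (2 * L)))]; congr! 1; ring
      · rw [← neg_inj (b := -(1 : ZMod (2 * L))), neg_neg]; congr! 1; ring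
    · rw [refl_apply_ne hk, refl_apply_ne hk]; exact bond_apply_same h
  · by_cases hl' : l = j
    · subst hl'
      rw [refl_apply_same, refl_apply_same, bond_apply_ne h hl]
    · rw [refl_apply_ne hl', refl_apply_ne hl', bond_apply_ne h hl]

theorem refl_sub (h : x - y = z - w) :
    refl j p x - refl j p y = refl j p z - refl j p w := by
  ext l
  have hl := congrFun h l
  rw [Pi.sub_apply, Pi.sub_apply] at hl ⊢
  by_cases hlj : l = j
  · subst hlj
    simp only [refl_apply_same]
    linear_combination -hl
  · simpa only [refl_apply_ne hlj] using hl

theorem refl_update_ne {l : Fin d} (hl : l ≠ j) (s : ZMod (2 * L)) :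
    refl j p (Function.update x l s) = Function.update (refl j p x) l s := by
  rw [refl, refl, Function.update_of_ne (Ne.symm hl), Function.update_comm (Ne.symm hl)]

theorem refl_update_same (s : ZMod (2 * L)) :
    refl j p (Function.update x j s) = Function.update x j (2 * p - 1 - s) := by
  simp [refl]

theorem inHalf_congr (h : x j = y j) : InHalf j p x ↔ InHalf j p y := by rw [InHalf, InHalf, h]

theorem inHalf_natCast {i : ℕ} (hi : i < 2 * L) (h : x j = p + i) : InHalf j p x ↔ i < L := by
  rw [InHalf, h, add_sub_cancel_left, ZMod.val_natCast_of_lt hi]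

theorem two_mul_natCast_eq_zero : (2 * L : ZMod (2 * L)) = 0 := by
  have := ZMod.natCast_self (2 * L)
  push_cast at this
  exact this

theorem refl_add : refl (L := L) j (p + (L : ZMod (2 * L))) x = refl j p x := by
  rw [refl, refl]
  congr 1
  linear_combination two_mul_natCast_eq_zero (L := L)

theorem inHalf_iff_of_bond_ne (hk : k ≠ j) (h : Bond k x y) : InHalf j p x ↔ InHalf j p y :=
  inHalf_congr (bond_apply_ne h (Ne.symm hk))

variable [NeZero L]

theorem val_add_one {s : ZMod (2 * L)} (h : s.val + 1 < 2 * L) : (s + 1).val = s.val + 1 := by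
  rw [← ZMod.natCast_zmod_val s, ← Nat.cast_succ, ZMod.val_natCast_of_lt h, ZMod.natCast_zmod_val]

theorem val_neg_one_sub (s : ZMod (2 * L)) : (-1 - s).val = 2 * L - 1 - s.val := by
  have h := s.val_lt
  have h1 : (-1 - s) = ((2 * L - 1 - s.val : ℕ) : ZMod (2 * L)) := by
    rw [Nat.cast_sub (by omega), Nat.cast_sub (by omega), ZMod.natCast_self, ZMod.natCast_zmod_val]
    simp
  rw [h1, ZMod.val_natCast_of_lt (by omega)]

theorem inHalf_refl : InHalf j p (refl j p x) ↔ ¬InHalf j p x := by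
  have h1 : 2 * p - 1 - x j - p = -1 - (x j - p) := by ring
  have h2 := (x j - p).val_lt
  rw [InHalf, InHalf, refl_apply_same, h1, val_neg_one_sub]
  omega

theorem exists_eq_add_natCast (p s : ZMod (2 * L)) : ∃ i < 2 * L, s = p + (i : ZMod (2 * L)) :=
  ⟨(s - p).val, ZMod.val_lt _, by rw [ZMod.natCast_zmod_val]; ring⟩

theorem inHalf_add : InHalf j (p + (L : ZMod (2 * L))) x ↔ ¬InHalf j p x := by
  obtain ⟨i, hi, h⟩ := exists_eq_add_natCast p (x j)
  rw [inHalf_natCast hi h]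
  by_cases hiL : i < L
  · have h2 : x j = p + L + ((i + L : ℕ) : ZMod (2 * L)) := by
      push_cast
      linear_combination h - two_mul_natCast_eq_zero (L := L)
    rw [inHalf_natCast (by omega) h2]; omega
  · have h2 : x j = p + L + ((i - L : ℕ) : ZMod (2 * L)) := by
      rw [Nat.cast_sub (by omega)]
      linear_combination h
    rw [inHalf_natCast (by omega) h2]; omega

/-- A bond between the two halves connects a site with its mirror image. -/
theorem eq_refl_of_bond (h : Bond k x y) (hx : InHalf j p x) (hy : ¬InHalf j p y) :
    y = refl j p x := by
  have hk : k = j := by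
    by_contra hk
    exact hy ((inHalf_iff_of_bond_ne hk h).1 hx)
  subst hk
  ext l
  by_cases hl : l = k
  · subst hl
    rw [refl_apply_same]
    have hs := (x l - p).val_lt
    have hs' := (y l - p).val_lt
    rw [InHalf] at hx hy
    have key : y l - p = -1 - (x l - p) := by
      apply ZMod.val_injective
      rw [val_neg_one_sub]
      rcases bond_apply_same h with h1 | h1
      · have h2 : x l - p = (y l - p) + 1 := by linear_combination h1
        by_cases h3 : (y l - p).val + 1 < 2 * L
        · have := val_add_one h3
          rw [← h2] at this
          omega
        · have h4 : y l - p = -1 - 0 := by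
            apply ZMod.val_injective
            rw [val_neg_one_sub, ZMod.val_zero]; omega
          have h5 : x l - p = 0 := by rw [h2, h4]; ring
          rw [h5, ZMod.val_zero]; omega
      · have h2 : y l - p = (x l - p) + 1 := by linear_combination -h1
        have hL : 0 < L := Nat.pos_of_ne_zero (NeZero.ne L)
        have := val_add_one (s := x l - p) (by omega)
        rw [← h2] at this
        omega
    linear_combination key
  · rw [refl_apply_ne hl, bond_apply_ne h hl]

theorem not_bond_self : ¬Bond k x x := by
  have hL : 0 < L := Nat.pos_of_ne_zero (NeZero.ne L)
  have : Fact (1 < 2 * L) := ⟨by omega⟩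
  intro h
  rcases bond_apply_same h with h | h <;> simp at h

end Geometry

/-! ### Gauge fields and their fluxes -/

/-- A gauge field on the torus assigns a phase to each pair of sites, and the inverse phase to the
reversed pair. -/
def IsGaugeField {V : Type} (U : V → V → Circle) : Prop := ∀ x y, U y x = (U x y)⁻¹

/-- The gauge transform of `U` by `g`. -/
noncomputable def gaugeTransform {V : Type} (g : V → Circle) (U : V → V → Circle) : V → V → Circle :=
  fun x y => g x * U x y * (g y)⁻¹

open Classical in
/-- The gauge field which agrees with `U` on one half, with its reflection on the other half up to
the sign `-1` due to the particle-hole transformation, and is `-1` between the halves. -/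
noncomputable def fold {d L : ℕ} (j : Fin d) (p : ZMod (2 * L))
    (U : Torus d L → Torus d L → Circle) : Torus d L → Torus d L → Circle := fun x y =>
  if InHalf j p x ∧ InHalf j p y then U x y
  else if ¬InHalf j p x ∧ ¬InHalf j p y then -U (refl j p x) (refl j p y)
  else -1

/-- The flux through the plaquette with corners `a`, `b`, `c`, `d`, as a phase. -/
noncomputable def cornerFlux {V : Type} (U : V → V → Circle) (a b c d : V) : Circle :=
  U b a * U c b * U d c * U a d

/-- The flux through the large circle in direction `l` through `x`, as a phase. -/
noncomputable def loopFlux {d L : ℕ} [NeZero L] (U : Torus d L → Torus d L → Circle) (x : Torus d L)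
    (l : Fin d) : Circle :=
  ∏ s : ZMod (2 * L), U (Function.update x l (s + 1)) (Function.update x l s)

/-- `a`, `b`, `c`, `d` are the corners of a plaquette, in cyclic order. Both orientations and all
four starting points are allowed, so that this notion is invariant under reflections. -/
def IsPlaquette {d L : ℕ} (a b c e : Torus d L) : Prop :=
  ∃ k l : Fin d, k ≠ l ∧ Bond k b a ∧ Bond l e a ∧ c - b = e - a

/-- The closed loops whose fluxes determine a gauge field on the torus: quadruples of corners and
large circles. -/
abbrev Loop (d L : ℕ) : Type :=
  (Torus d L × Torus d L × Torus d L × Torus d L) ⊕ (Torus d L × Fin d)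

/-- `U` has the canonical flux through a loop: `π` through plaquettes, and `π` or `0` through large
circles according to whether `L` is even or odd. A quadruple which is not a plaquette satisfies this
by convention. -/
def HasCanonicalFlux {d L : ℕ} [NeZero L] (U : Torus d L → Torus d L → Circle) :
    Loop d L → Prop
  | Sum.inl (a, b, c, e) => IsPlaquette a b c e → cornerFlux U a b c e = -1
  | Sum.inr (x, l) => loopFlux U x l = -(-1) ^ L

/-- The reflection of a loop. -/
def reflLoop {d L : ℕ} (j : Fin d) (p : ZMod (2 * L)) : Loop d L → Loop d L
  | Sum.inl (a, b, c, e) => Sum.inl (refl j p a, refl j p b, refl j p c, refl j p e)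
  | Sum.inr (x, l) => Sum.inr (refl j p x, l)

/-- The loop crosses the reflection plane. -/
def IsCut {d L : ℕ} (j : Fin d) (p : ZMod (2 * L)) : Loop d L → Prop
  | Sum.inl (a, b, c, e) => IsPlaquette a b c e ∧
      ¬(InHalf j p a ∧ InHalf j p b ∧ InHalf j p c ∧ InHalf j p e) ∧
      ¬(¬InHalf j p a ∧ ¬InHalf j p b ∧ ¬InHalf j p c ∧ ¬InHalf j p e)
  | Sum.inr (_, l) => l = j

section Flux

variable {d L : ℕ} {j : Fin d} {p : ZMod (2 * L)} {U : Torus d L → Torus d L → Circle}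

theorem reflLoop_reflLoop (i : Loop d L) : reflLoop j p (reflLoop j p i) = i := by
  rcases i with ⟨a, b, c, e⟩ | ⟨x, l⟩ <;> simp [reflLoop, refl_refl]

theorem isPlaquette_refl {a b c e : Torus d L} :
    IsPlaquette (refl j p a) (refl j p b) (refl j p c) (refl j p e) ↔ IsPlaquette a b c e := by
  suffices h : ∀ a b c e : Torus d L, IsPlaquette a b c e →
      IsPlaquette (refl j p a) (refl j p b) (refl j p c) (refl j p e) by
    refine ⟨fun h1 => ?_, h a b c e⟩
    have := h _ _ _ _ h1
    simpa only [refl_refl] using this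
  rintro a b c e ⟨k, l, hkl, h1, h2, h3⟩
  exact ⟨k, l, hkl, bond_refl.2 h1, bond_refl.2 h2, refl_sub h3⟩

theorem IsGaugeField.gaugeTransform {V : Type} {U : V → V → Circle} (hU : IsGaugeField U)
    (g : V → Circle) : IsGaugeField (gaugeTransform g U) := fun x y => by
  rw [FluxPhase.gaugeTransform, FluxPhase.gaugeTransform, hU x y]
  simp only [mul_inv, inv_inv]
  rw [mul_comm (g x)⁻¹, mul_comm (g y), mul_assoc, mul_comm (g y), mul_assoc]

theorem cornerFlux_gaugeTransform {V : Type} (g : V → Circle) (U : V → V → Circle) (a b c d : V) :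
    cornerFlux (gaugeTransform g U) a b c d = cornerFlux U a b c d := by
  unfold cornerFlux gaugeTransform
  calc _ = (U b a * U c b * U d c * U a d) * ((g a)⁻¹ * g a) * ((g b)⁻¹ * g b) * ((g c)⁻¹ * g c)
        * ((g d)⁻¹ * g d) := by
        simp only [mul_comm, mul_left_comm, mul_assoc]
    _ = _ := by simp

theorem loopFlux_gaugeTransform [NeZero L] (g : Torus d L → Circle) (x : Torus d L) (l : Fin d) :
    loopFlux (gaugeTransform g U) x l = loopFlux U x l := by
  unfold loopFlux gaugeTransform
  have h : ∏ s : ZMod (2 * L), g (Function.update x l (s + 1))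
      = ∏ s : ZMod (2 * L), g (Function.update x l s) :=
    Fintype.prod_equiv (Equiv.addRight 1) _ _ fun s => rfl
  rw [Finset.prod_mul_distrib, Finset.prod_mul_distrib, Finset.prod_inv_distrib, h, mul_comm, ← mul_assoc, inv_mul_cancel, one_mul]

theorem hasCanonicalFlux_gaugeTransform [NeZero L] (g : Torus d L → Circle) (i : Loop d L) :
    HasCanonicalFlux (gaugeTransform g U) i ↔ HasCanonicalFlux U i := by
  rcases i with ⟨a, b, c, e⟩ | ⟨x, l⟩
  · simp only [HasCanonicalFlux, cornerFlux_gaugeTransform]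
  · simp only [HasCanonicalFlux, loopFlux_gaugeTransform]

theorem fold_of_inHalf {x y : Torus d L} (hx : InHalf j p x) (hy : InHalf j p y) :
    fold j p U x y = U x y := by rw [fold, if_pos ⟨hx, hy⟩]

theorem fold_of_not_inHalf {x y : Torus d L} (hx : ¬InHalf j p x) (hy : ¬InHalf j p y) :
    fold j p U x y = -U (refl j p x) (refl j p y) := by
  rw [fold, if_neg (fun h => hx h.1), if_pos ⟨hx, hy⟩]

theorem fold_of_cross {x y : Torus d L} (h : ¬(InHalf j p x ↔ InHalf j p y)) :
    fold j p U x y = -1 := by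
  rw [fold, if_neg (by tauto), if_neg (by tauto)]

theorem isGaugeField_fold (hU : IsGaugeField U) : IsGaugeField (fold j p U) := fun x y => by
  by_cases hx : InHalf j p x <;> by_cases hy : InHalf j p y
  · rw [fold_of_inHalf hx hy, fold_of_inHalf hy hx, hU x y]
  · rw [fold_of_cross (by tauto), fold_of_cross (by tauto)]; simp [inv_neg]
  · rw [fold_of_cross (by tauto), fold_of_cross (by tauto)]; simp [inv_neg]
  · rw [fold_of_not_inHalf hx hy, fold_of_not_inHalf hy hx, hU (refl j p x)]; simp [inv_neg]

variable [NeZero L]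

theorem prod_zmod {A : Type} [CommMonoid A] (n : ℕ) [NeZero n] (f : ZMod n → A) :
    ∏ s, f s = ∏ i ∈ Finset.range n, f i := by
  refine Finset.prod_bij' (fun s _ => s.val) (fun i _ => (i : ZMod n)) ?_ ?_ ?_ ?_ ?_
  · intro s _; exact Finset.mem_range.2 s.val_lt
  · intro i _; exact Finset.mem_univ _
  · intro s _; exact ZMod.natCast_zmod_val s
  · intro i hi; exact ZMod.val_natCast_of_lt (Finset.mem_range.1 hi)
  · intro s _; rw [ZMod.natCast_zmod_val]

/-- The large circles orthogonal to the reflection planes: the `L - 1` bonds of each half combine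
to `(-1) ^ (L - 1)`, and the two bonds between the halves to `1`. -/
theorem loopFlux_fold (hU : IsGaugeField U) (x : Torus d L) :
    loopFlux (fold j p U) x j = -(-1) ^ L := by
  obtain ⟨m, hm⟩ : ∃ m, L = m + 1 := Nat.exists_eq_succ_of_ne_zero (NeZero.ne L)
  set γ : ℕ → Torus d L := fun i => Function.update x j (p + i) with hγ
  have hhalf : ∀ i, i < 2 * L → (InHalf j p (γ i) ↔ i < L) := fun i hi =>
    inHalf_natCast hi (by simp [hγ])
  have h2L := two_mul_natCast_eq_zero (L := L)
  have hγ0 : γ (2 * L) = γ 0 := by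
    simp only [hγ]; congr 1; push_cast; rw [h2L]
  have hr : ∀ i i' : ℕ, i + i' + 1 = 2 * L → refl j p (γ i) = γ i' := fun i i' h => by
    simp only [hγ, refl_update_same]
    congr 1
    have : ((i + i' + 1 : ℕ) : ZMod (2 * L)) = 0 := by rw [h, ZMod.natCast_self]
    push_cast at this
    linear_combination -this
  have hF : loopFlux (fold j p U) x j
      = ∏ i ∈ Finset.range (2 * L), fold j p U (γ (i + 1)) (γ i) := by
    rw [loopFlux, ← Fintype.prod_equiv (Equiv.addLeft p) (fun s => fold j p U
      (Function.update x j (p + s + 1)) (Function.update x j (p + s))) _ fun s => rfl, prod_zmod]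
    refine Finset.prod_congr rfl fun i _ => ?_
    simp only [hγ]
    push_cast
    rw [add_assoc]
  -- `m` bonds in the half, a bond between the halves, `m` reflected bonds, and the closing bond
  have hsplit : 2 * L = m + 1 + m + 1 := by omega
  rw [hF, hsplit, Finset.prod_range_succ, Finset.prod_range_add, Finset.prod_range_succ]
  have e1 : fold j p U (γ (m + 1)) (γ m) = -1 := by
    apply fold_of_cross
    rw [hhalf _ (by omega), hhalf _ (by omega)]; omega
  have e2 : fold j p U (γ (m + 1 + m + 1)) (γ (m + 1 + m)) = -1 := by
    apply fold_of_cross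
    rw [← hsplit, hγ0, hhalf _ (by omega), hhalf _ (by omega)]; omega
  have e3 : ∏ i ∈ Finset.range m, fold j p U (γ (m + 1 + i + 1)) (γ (m + 1 + i))
      = ∏ i ∈ Finset.range m, -U (γ i) (γ (i + 1)) := by
    rw [← Finset.prod_range_reflect]
    refine Finset.prod_congr rfl fun i hi => ?_
    rw [Finset.mem_range] at hi
    rw [fold_of_not_inHalf (by rw [hhalf _ (by omega)]; omega)
      (by rw [hhalf _ (by omega)]; omega), hr _ i (by omega), hr _ (i + 1) (by omega)]
  have e4 : ∏ i ∈ Finset.range m, fold j p U (γ (i + 1)) (γ i)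
      = ∏ i ∈ Finset.range m, U (γ (i + 1)) (γ i) := by
    refine Finset.prod_congr rfl fun i hi => ?_
    rw [Finset.mem_range] at hi
    rw [fold_of_inHalf (by rw [hhalf _ (by omega)]; omega) (by rw [hhalf _ (by omega)]; omega)]
  rw [e1, e2, e3, e4]
  have e5 : (∏ i ∈ Finset.range m, U (γ (i + 1)) (γ i))
      * ∏ i ∈ Finset.range m, -U (γ i) (γ (i + 1)) = (-1) ^ m := by
    rw [← Finset.prod_mul_distrib]
    have : ∀ i ∈ Finset.range m, U (γ (i + 1)) (γ i) * -U (γ i) (γ (i + 1)) = -1 := fun i _ => by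
      rw [hU (γ i) (γ (i + 1)), mul_neg, inv_mul_cancel]
    rw [Finset.prod_congr rfl this]; simp
  calc _ = ((∏ i ∈ Finset.range m, U (γ (i + 1)) (γ i))
      * ∏ i ∈ Finset.range m, -U (γ i) (γ (i + 1))) := by
        simp
    _ = -(-1) ^ L := by rw [e5, hm, pow_succ]; simp

theorem cornerFlux_fold_of_bond (hU : IsGaugeField U) {a b c e : Torus d L} (hba : Bond j b a)
    (hce : Bond j c e) (hae : InHalf j p a ↔ InHalf j p e) (hbc : InHalf j p b ↔ InHalf j p c)
    (hab : ¬(InHalf j p a ↔ InHalf j p b)) :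
    cornerFlux (fold j p U) a b c e = -1 := by
  unfold cornerFlux
  rw [fold_of_cross (x := b) (y := a) (by tauto), fold_of_cross (x := e) (y := c) (by tauto)]
  by_cases ha : InHalf j p a
  · have hb : ¬InHalf j p b := by tauto
    have he : InHalf j p e := by tauto
    have hc : ¬InHalf j p c := by tauto
    rw [fold_of_not_inHalf hc hb, fold_of_inHalf ha he,
      eq_refl_of_bond (bond_comm.1 hba) ha hb, eq_refl_of_bond (bond_comm.1 hce) he hc, refl_refl,
      refl_refl, hU a e]
    simp
  · have hb : InHalf j p b := by tauto
    have he : ¬InHalf j p e := by tauto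
    have hc : InHalf j p c := by tauto
    rw [fold_of_inHalf hc hb, fold_of_not_inHalf ha he,
      eq_refl_of_bond hba hb ha, eq_refl_of_bond hce hc he, refl_refl,
      refl_refl, hU b c]
    simp

theorem cornerFlux_rotate {V : Type} (U : V → V → Circle) (a b c d : V) :
    cornerFlux U a b c d = cornerFlux U b c d a := by
  unfold cornerFlux
  rw [mul_comm, ← mul_assoc, ← mul_assoc, mul_comm, mul_comm _ (U b a)]
  simp only [mul_comm, mul_left_comm]

/-- Loops which cross the reflection plane acquire the canonical flux. -/
theorem hasCanonicalFlux_fold_of_isCut (hU : IsGaugeField U) {i : Loop d L} (hi : IsCut j p i) :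
    HasCanonicalFlux (fold j p U) i := by
  rcases i with ⟨a, b, c, e⟩ | ⟨x, l⟩
  · obtain ⟨⟨k, l, hkl, h1, h2, h3⟩, hn1, hn2⟩ := hi
    intro _
    have h4 : Bond l c b := bond_of_sub_eq h2 h3
    have h5 : Bond k c e := bond_of_sub_eq h1 (by linear_combination (exp := 1) h3)
    by_cases hk : k = j
    · subst hk
      have e1 := inHalf_iff_of_bond_ne (p := p) (Ne.symm hkl) h2
      have e2 := inHalf_iff_of_bond_ne (p := p) (Ne.symm hkl) h4
      exact cornerFlux_fold_of_bond hU h1 h5 e1.symm e2.symm (by tauto)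
    · have e1 := inHalf_iff_of_bond_ne (p := p) hk h1
      have e2 := inHalf_iff_of_bond_ne (p := p) hk h5
      by_cases hl : l = j
      · subst hl
        rw [cornerFlux_rotate]
        exact cornerFlux_fold_of_bond hU h4 h2 e1 e2 (by tauto)
      · have e3 := inHalf_iff_of_bond_ne (p := p) hl h2
        tauto
  · obtain rfl : l = j := hi
    exact loopFlux_fold hU x

/-- Loops which do not cross the reflection plane keep their flux if they lie in the half from which
the field is reflected, and take over the flux of their mirror image otherwise. -/
theorem hasCanonicalFlux_fold_of_not_isCut {i : Loop d L} (hi : ¬IsCut j p i) :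
    (HasCanonicalFlux (fold j p U) i ↔ HasCanonicalFlux U i) ∧
        (HasCanonicalFlux (fold j (p + (L : ZMod (2 * L))) U) i ↔ HasCanonicalFlux U (reflLoop j p i)) ∨
      (HasCanonicalFlux (fold j p U) i ↔ HasCanonicalFlux U (reflLoop j p i)) ∧
        (HasCanonicalFlux (fold j (p + (L : ZMod (2 * L))) U) i ↔ HasCanonicalFlux U i) := by
  have hplus : ∀ x, InHalf j (p + (L : ZMod (2 * L))) x ↔ ¬InHalf j p x := fun x => inHalf_add
  rcases i with ⟨a, b, c, e⟩ | ⟨x, l⟩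
  · simp only [HasCanonicalFlux, reflLoop, isPlaquette_refl]
    by_cases hpl : IsPlaquette a b c e
    · have hA : ∀ q, InHalf j q a → InHalf j q b → InHalf j q c → InHalf j q e →
          cornerFlux (fold j q U) a b c e = cornerFlux U a b c e := fun q ha hb hc he => by
        simp only [cornerFlux, fold_of_inHalf, ha, hb, hc, he]
      have hB : ∀ q, ¬InHalf j q a → ¬InHalf j q b → ¬InHalf j q c → ¬InHalf j q e →
          cornerFlux (fold j q U) a b c e
            = cornerFlux U (refl j q a) (refl j q b) (refl j q c) (refl j q e) :=
        fun q ha hb hc he => by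
          simp only [cornerFlux, fold_of_not_inHalf ha he, fold_of_not_inHalf hb ha,
            fold_of_not_inHalf hc hb, fold_of_not_inHalf he hc, neg_mul, mul_neg, neg_neg]
      simp only [IsCut, hpl, true_and] at hi
      by_cases ha : InHalf j p a
      · left
        have : InHalf j p b ∧ InHalf j p c ∧ InHalf j p e := by tauto
        obtain ⟨hb, hc, he⟩ := this
        rw [hA p ha hb hc he, hB (p + (L : ZMod (2 * L))) (by simp [hplus, ha]) (by simp [hplus, hb])
          (by simp [hplus, hc]) (by simp [hplus, he])]
        simp only [refl_add, and_self]
      · right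
        have : ¬InHalf j p b ∧ ¬InHalf j p c ∧ ¬InHalf j p e := by tauto
        obtain ⟨hb, hc, he⟩ := this
        rw [hB p ha hb hc he, hA (p + (L : ZMod (2 * L))) (by simp [hplus, ha]) (by simp [hplus, hb])
          (by simp [hplus, hc]) (by simp [hplus, he])]
        simp only [and_self]
    · simp [hpl]
  · have hl : l ≠ j := hi
    have hup : ∀ q s, InHalf j q (Function.update x l s) ↔ InHalf j q x := fun q s =>
      inHalf_congr (by simp [Ne.symm hl])
    have hA : ∀ q, InHalf j q x → loopFlux (fold j q U) x l = loopFlux U x l := fun q hx => by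
      unfold loopFlux
      refine Finset.prod_congr rfl fun s _ => ?_
      rw [fold_of_inHalf ((hup q _).2 hx) ((hup q _).2 hx)]
    have hB : ∀ q, ¬InHalf j q x → loopFlux (fold j q U) x l = loopFlux U (refl j q x) l :=
      fun q hx => by
        unfold loopFlux
        have : ∀ s : ZMod (2 * L), fold j q U (Function.update x l (s + 1)) (Function.update x l s)
            = -1 * U (Function.update (refl j q x) l (s + 1)) (Function.update (refl j q x) l s) :=
          fun s => by
            rw [fold_of_not_inHalf (by rwa [hup]) (by rwa [hup]), refl_update_ne hl,
              refl_update_ne hl, neg_one_mul]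
        simp only [this]
        rw [Finset.prod_mul_distrib]
        simp [ZMod.card]
    simp only [HasCanonicalFlux, reflLoop]
    by_cases hx : InHalf j p x
    · left
      rw [hA p hx, hB (p + (L : ZMod (2 * L))) (by simp [hplus, hx])]
      simp only [refl_add, and_self]
    · right
      rw [hB p hx, hA (p + (L : ZMod (2 * L))) (by simp [hplus, hx])]
      simp only [and_self]

end Flux

/-! ### The partition function of a gauge field -/

section GaugePartition

variable {d L : ℕ}

open Classical in
/-- The modulus of the hopping amplitude between two sites. -/
noncomputable def bondWeight (t : Fin d → ℝ) (x y : Torus d L) : ℝ :=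
  ∑ j, if Bond j x y then t j else 0

/-- The hopping amplitudes of a gauge field. -/
noncomputable def amplitude (t : Fin d → ℝ) (U : Torus d L → Torus d L → Circle)
    (x y : Torus d L) : ℂ := (bondWeight t x y : ℂ) * (U x y : ℂ)

variable {t : Fin d → ℝ} {U : Torus d L → Torus d L → Circle}

theorem bondWeight_comm (x y : Torus d L) : bondWeight t x y = bondWeight t y x := by
  classical
  exact Finset.sum_congr rfl fun _ _ => if_congr bond_comm rfl rfl

theorem bondWeight_refl (j : Fin d) (p : ZMod (2 * L)) (x y : Torus d L) :
    bondWeight t (refl j p x) (refl j p y) = bondWeight t x y := by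
  classical
  exact Finset.sum_congr rfl fun _ _ => if_congr bond_refl rfl rfl

theorem bondWeight_nonneg (ht : ∀ j, 0 ≤ t j) (x y : Torus d L) : 0 ≤ bondWeight t x y :=
  Finset.sum_nonneg fun j _ => by split_ifs <;> simp [ht]

theorem bondWeight_eq_zero {x y : Torus d L} (h : ∀ k, ¬Bond k x y) : bondWeight t x y = 0 :=
  Finset.sum_eq_zero fun j _ => if_neg (h j)

theorem amplitude_conj (hU : IsGaugeField U) (x y : Torus d L) :
    (starRingEnd ℂ) (amplitude t U x y) = amplitude t U y x := by
  rw [amplitude, amplitude, map_mul, Complex.conj_ofReal, bondWeight_comm, hU x y,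
    Circle.coe_inv_eq_conj]

variable [NeZero L]

theorem amplitude_self (x : Torus d L) : amplitude t U x x = 0 := by
  rw [amplitude, bondWeight_eq_zero fun k => not_bond_self]; simp

variable {j : Fin d} {p : ZMod (2 * L)}

/-- The torus is the union of a half and its mirror image. -/
noncomputable def halfEquiv (j : Fin d) (p : ZMod (2 * L)) :
    {x : Torus d L // InHalf j p x} ⊕ {x : Torus d L // InHalf j p x} ≃ Torus d L :=
  Equiv.ofBijective (Sum.elim (fun x => x.1) (fun x => refl j p x.1)) (by
    constructor
    · rintro (x | x) (y | y) h
      · exact congrArg _ (Subtype.ext h)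
      · have h' : x.1 = refl j p y.1 := h
        exact absurd y.2 (inHalf_refl.1 (h' ▸ x.2))
      · have h' : refl j p x.1 = y.1 := h
        exact absurd x.2 (inHalf_refl.1 (h' ▸ y.2))
      · have h' := congrArg (refl j p) (show refl j p x.1 = refl j p y.1 from h)
        rw [refl_refl, refl_refl] at h'
        exact congrArg _ (Subtype.ext h')
    · intro x
      by_cases hx : InHalf j p x
      · exact ⟨Sum.inl ⟨x, hx⟩, rfl⟩
      · exact ⟨Sum.inr ⟨refl j p x, inHalf_refl.2 hx⟩, refl_refl⟩)

theorem halfEquiv_inl (x : {x : Torus d L // InHalf j p x}) :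
    halfEquiv j p (Sum.inl x) = x.1 := rfl

theorem halfEquiv_inr (x : {x : Torus d L // InHalf j p x}) :
    halfEquiv j p (Sum.inr x) = refl j p x.1 := rfl

theorem bondWeight_cross {x y : Torus d L} (hx : InHalf j p x) (hy : InHalf j p y) (h : x ≠ y) :
    bondWeight t x (refl j p y) = 0 := by
  refine bondWeight_eq_zero fun k hk => h ?_
  have := eq_refl_of_bond hk hx (fun h2 => inHalf_refl.1 h2 hy)
  rw [← refl_refl (j := j) (p := p) (x := x), ← this, refl_refl]

theorem amplitude_halfEquiv (hU : IsGaugeField U)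
    (hcross : ∀ x, InHalf j p x → U x (refl j p x) = -1) :
    (fun a b => amplitude t U (halfEquiv j p a) (halfEquiv j p b))
      = glue (fun x => bondWeight t x.1 (refl j p x.1)) (fun x y => amplitude t U x.1 y.1)
          (fun x y => -amplitude t U (refl j p x.1) (refl j p y.1)) := by
  funext a b
  rcases a with x | x <;> rcases b with y | y
  · rfl
  · simp only [glue, halfEquiv_inl, halfEquiv_inr]
    by_cases hxy : x = y
    · subst hxy
      rw [if_pos rfl, amplitude, hcross x.1 x.2]; simp
    · rw [if_neg hxy, amplitude, bondWeight_cross x.2 y.2 (fun h => hxy (Subtype.ext h))]; simp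
  · simp only [glue, halfEquiv_inl, halfEquiv_inr]
    by_cases hxy : x = y
    · subst hxy
      rw [if_pos rfl, amplitude, hU x.1, hcross x.1 x.2, bondWeight_comm]; simp [inv_neg]
    · rw [if_neg hxy, amplitude, bondWeight_comm,
        bondWeight_cross y.2 x.2 (fun h => hxy (Subtype.ext h.symm))]; simp
  · simp only [glue, halfEquiv_inr, neg_neg]

variable {K M : Type} [Fintype K] [Fintype M] [LinearOrder M]

/-- The couplings on one half of the torus. -/
def Couplings.half (c : Couplings (Torus d L) K) (j : Fin d) (p : ZMod (2 * L)) :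
    Couplings {x : Torus d L // InHalf j p x} K :=
  { c with adj := fun x y => c.adj x.1 y.1 }

omit [Fintype K] in
theorem comap_halfEquiv (c : Couplings (Torus d L) K)
    (hadj : ∀ x y, c.adj x y ↔ ∃ k, Bond k x y) :
    c.comap (halfEquiv j p) = (c.half j p).double (fun x => c.adj x.1 (refl j p x.1)) := by
  have hcross : ∀ x y : {x : Torus d L // InHalf j p x},
      c.adj x.1 (refl j p y.1) ↔ x = y ∧ c.adj x.1 (refl j p x.1) := fun x y => by
    constructor
    · intro h
      have hxy : x = y := by
        by_contra hne
        obtain ⟨k, hk⟩ := (hadj _ _).1 h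
        have := eq_refl_of_bond hk x.2 (fun h2 => inHalf_refl.1 h2 y.2)
        apply hne
        apply Subtype.ext
        rw [← refl_refl (j := j) (p := p) (x := x.1), ← this, refl_refl]
      exact ⟨hxy, by rw [hxy] at h ⊢; exact h⟩
    · rintro ⟨rfl, h⟩; exact h
  have hsymm : ∀ x y, c.adj x y ↔ c.adj y x := fun x y => by
    simp only [hadj, bond_comm (x := x)]
  have : (c.comap (halfEquiv j p)).adj
      = ((c.half j p).double (fun x => c.adj x.1 (refl j p x.1))).adj := by
    funext a b
    rcases a with x | x <;> rcases b with y | y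
    · rfl
    · exact propext (hcross x y)
    · refine propext ((hsymm _ _).trans ((hcross y x).trans ?_))
      change _ ↔ x = y ∧ c.adj x.1 (refl j p x.1)
      constructor
      · rintro ⟨rfl, h⟩; exact ⟨rfl, h⟩
      · rintro ⟨rfl, h⟩; exact ⟨rfl, h⟩
    · refine propext ?_
      change c.adj (refl j p x.1) (refl j p y.1) ↔ c.adj x.1 y.1
      simp only [hadj, bond_refl]
  unfold Couplings.comap Couplings.double Couplings.half at this ⊢
  simp only at this
  rw [this]

theorem partition_comap {Λ Λ' : Type} [Fintype Λ] [Fintype Λ'] (e : Λ' ≃ Λ) (c : Couplings Λ K)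
    (β : ℝ) (m : Λ × Spin ≃ M) (h : Λ → Λ → ℂ) :
    partition (c.comap e) β ((Equiv.prodCongr e (Equiv.refl Spin)).trans m)
      (fun x y => h (e x) (e y)) = partition c β m h := by
  rw [partition, partition, ← hubbard_comap e c h]
  rfl

/-- The partition function of a gauge field. -/
noncomputable def gaugePartition (c : Couplings (Torus d L) K) (β : ℝ)
    (m : Torus d L × Spin ≃ M) (t : Fin d → ℝ) (U : Torus d L → Torus d L → Circle) : ℝ :=
  (partition c β m (amplitude t U)).re

theorem gaugePartition_pos (c : Couplings (Torus d L) K)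
    (hadj : ∀ x y, c.adj x y ↔ ∃ k, Bond k x y) (β : ℝ) (m : Torus d L × Spin ≃ M)
    (hU : IsGaugeField U) :
    (partition c β m (amplitude t U)).im = 0 ∧ 0 < gaugePartition c β m t U :=
  partition_pos c (fun x y => by simp only [hadj, bond_comm (x := x), imp_self]) β m
    (amplitude_conj hU)

/-- Reflecting a gauge field in the two halves of the torus increases the geometric mean of the
partition functions, provided that the gauge field is `-1` on the bonds between the halves. -/
theorem gaugePartition_sq_le (c : Couplings (Torus d L) K)
    (hadj : ∀ x y, c.adj x y ↔ ∃ k, Bond k x y) {β : ℝ} (hβ : 0 ≤ β) (m : Torus d L × Spin ≃ M)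
    (ht : ∀ j, 0 ≤ t j) (hU : IsGaugeField U)
    (hcross : ∀ x, InHalf j p x → U x (refl j p x) = -1) :
    gaugePartition c β m t U ^ 2
      ≤ gaugePartition c β m t (fold j p U) * gaugePartition c β m t (fold j (p + (L : ZMod (2 * L))) U) := by
  classical
  have hrefl : ∀ x : {x : Torus d L // InHalf j p x}, ¬InHalf j p (refl j p x.1) := fun x h =>
    inHalf_refl.1 h x.2
  have hplus : ∀ x, InHalf j (p + (L : ZMod (2 * L))) x ↔ ¬InHalf j p x := fun x => inHalf_add
  have hconv : ∀ W : Torus d L → Torus d L → Circle, IsGaugeField W →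
      (∀ x, InHalf j p x → W x (refl j p x) = -1) →
      partition c β m (amplitude t W) = partition ((c.half j p).double
        (fun x => c.adj x.1 (refl j p x.1))) β
        ((Equiv.prodCongr (halfEquiv j p) (Equiv.refl Spin)).trans m)
        (glue (fun x => bondWeight t x.1 (refl j p x.1)) (fun x y => amplitude t W x.1 y.1)
          (fun x y => -amplitude t W (refl j p x.1) (refl j p y.1))) := fun W hW hWc => by
    rw [← amplitude_halfEquiv hW hWc, ← comap_halfEquiv c hadj, partition_comap]
  have hl := hconv (fold j p U) (isGaugeField_fold hU) fun x hx =>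
    fold_of_cross (by rw [inHalf_refl]; tauto)
  have hr := hconv (fold j (p + (L : ZMod (2 * L))) U) (isGaugeField_fold hU) fun x hx =>
    fold_of_cross (by rw [hplus, hplus, inHalf_refl]; tauto)
  have e1 : (fun x y : {x : Torus d L // InHalf j p x} => amplitude t (fold j p U) x.1 y.1)
      = fun x y => amplitude t U x.1 y.1 := by
    funext x y
    rw [amplitude, fold_of_inHalf x.2 y.2, amplitude]
  have e2 : (fun x y : {x : Torus d L // InHalf j p x} =>
      -amplitude t (fold j p U) (refl j p x.1) (refl j p y.1))
      = fun x y => amplitude t U x.1 y.1 := by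
    funext x y
    rw [amplitude, fold_of_not_inHalf (hrefl x) (hrefl y), amplitude, refl_refl, refl_refl,
      bondWeight_refl]
    simp
  have e3 : (fun x y : {x : Torus d L // InHalf j p x} =>
      amplitude t (fold j (p + (L : ZMod (2 * L))) U) x.1 y.1)
      = fun x y => -amplitude t U (refl j p x.1) (refl j p y.1) := by
    funext x y
    rw [amplitude, fold_of_not_inHalf (by simpa [hplus] using x.2) (by simpa [hplus] using y.2),
      amplitude, bondWeight_refl, refl_add, refl_add]
    simp
  have e4 : (fun x y : {x : Torus d L // InHalf j p x} =>
      -amplitude t (fold j (p + (L : ZMod (2 * L))) U) (refl j p x.1) (refl j p y.1))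
      = fun x y => -amplitude t U (refl j p x.1) (refl j p y.1) := by
    funext x y
    rw [amplitude, fold_of_inHalf ((hplus _).2 (hrefl x)) ((hplus _).2 (hrefl y)), amplitude]
  rw [e1, e2] at hl
  rw [e3, e4] at hr
  unfold gaugePartition
  rw [hl, hr, hconv U hU hcross]
  refine le_trans ?_ (norm_partition_sq_le (c.half j p) _ hβ _
    (fun x => bondWeight_nonneg ht _ _) (fun x y => amplitude_conj hU _ _)
    (fun x => amplitude_self _) (fun x y => by rw [map_neg, amplitude_conj hU])
    (fun x => by rw [amplitude_self, neg_zero]))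
  exact sq_le_sq' (abs_le.1 (Complex.abs_re_le_norm _)).1 (Complex.re_le_norm _)

omit [NeZero L] in
theorem bilinear_gauge {g : Torus d L → Circle} (m : Torus d L × Spin ≃ M)
    {Φ : FockOp M →ₐ[ℂ] FockOp M}
    (hΦ : ∀ a, Φ (annihilation a) = ((g (m.symm a).1)⁻¹ : Circle) • annihilation a)
    (hstar : ∀ X, Φ Xᴴ = (Φ X)ᴴ) (x : Torus d L) (σ : Spin) (y : Torus d L) (τ : Spin) :
    Φ (bilinear m x σ y τ) = ((g x * (g y)⁻¹ : Circle) : ℂ) • bilinear m x σ y τ := by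
  have h : ∀ (z : Circle) (X : FockOp M), z • X = (z : ℂ) • X := fun z X => rfl
  rw [bilinear, map_mul, creation, hstar, hΦ, hΦ, h, h, Matrix.conjTranspose_smul,
    smul_mul_smul_comm]
  congr 1
  simp only [Circle.coe_mul, RCLike.star_def, Circle.coe_inv_eq_conj, Complex.conj_conj,
    Equiv.symm_apply_apply]

/-- Gauge invariance of the partition function. -/
theorem gaugePartition_gaugeTransform (c : Couplings (Torus d L) K) (β : ℝ)
    (m : Torus d L × Spin ≃ M) (g : Torus d L → Circle) :
    gaugePartition c β m t (gaugeTransform g U) = gaugePartition c β m t U := by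
  obtain ⟨Φ, hΦ, hstar, htr⟩ := exists_gaugeHom
    (g := fun a => (((g (m.symm a).1)⁻¹ : Circle) : ℂ)) (fun a => Circle.norm_coe _)
  have hb := bilinear_gauge m hΦ hstar
  have : hubbard c (amplitude t (gaugeTransform g U)) (bilinear m)
      = Φ (hubbard c (amplitude t U) (bilinear m)) := by
    rw [map_hubbard]
    have hsite : ∀ (x : Torus d L) (σ τ : Spin), Φ (bilinear m x σ x τ) = bilinear m x σ x τ :=
      fun x σ τ => by rw [hb]; simp
    simp only [hubbard, hopping, onSite, pairInteraction, siteObs, hsite]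
    congr 2
    refine Finset.sum_congr rfl fun x _ => Finset.sum_congr rfl fun y _ =>
      Finset.sum_congr rfl fun σ _ => ?_
    rw [hb, smul_smul, amplitude, amplitude, gaugeTransform]
    congr 1
    simp only [Circle.coe_mul]
    ring
  rw [gaugePartition, gaugePartition, partition, partition, this, ← map_smul, htr]

theorem continuous_gaugePartition (c : Couplings (Torus d L) K) (β : ℝ)
    (m : Torus d L × Spin ≃ M) : Continuous (gaugePartition c β m t) := by
  have h : Continuous fun U => hubbard c (amplitude t U) (bilinear m) := ?_
  · exact continuous_trace_exp.comp (h.const_smul (-β : ℂ))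
  refine Continuous.add (Continuous.add ?_ continuous_const) continuous_const
  refine continuous_finsetSum _ fun x _ => continuous_finsetSum _ fun y _ =>
    continuous_finsetSum _ fun σ _ => ?_
  have h1 : Continuous fun U : Torus d L → Torus d L → Circle => U x y :=
    continuous_apply_apply x y
  have h2 : Continuous fun U : Torus d L → Torus d L → Circle => amplitude t U x y :=
    continuous_const.mul (continuous_subtype_val.comp h1)
  exact h2.smul continuous_const

end GaugePartition

/-! ### A maximizer with canonical fluxes -/

section Maximizer

variable {d L : ℕ} [NeZero L] {K M : Type} [Fintype K] [Fintype M] [LinearOrder M]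

theorem eq_of_sq_le_mul {a b z : ℝ} (hz : 0 < z) (ha : 0 ≤ a) (haz : a ≤ z) (hbz : b ≤ z)
    (h : z ^ 2 ≤ a * b) : a = z := by
  refine le_antisymm haz (le_of_mul_le_mul_right ?_ hz)
  calc z * z = z ^ 2 := (sq z).symm
    _ ≤ a * b := h
    _ ≤ a * z := mul_le_mul_of_nonneg_left hbz ha

theorem exists_isCut (i : Loop d L) {U : Torus d L → Torus d L → Circle}
    (hi : ¬HasCanonicalFlux U i) : ∃ (j : Fin d) (p : ZMod (2 * L)), IsCut j p i := by
  have hL : 0 < L := Nat.pos_of_ne_zero (NeZero.ne L)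
  rcases i with ⟨a, b, c, e⟩ | ⟨x, l⟩
  · simp only [HasCanonicalFlux, Classical.not_imp] at hi
    obtain ⟨⟨k, l, hkl, h1, h2, h3⟩, _⟩ := hi
    -- the reflection plane is placed between the layers of `a` and `b`
    rcases bond_apply_same h1 with h | h
    · refine ⟨k, b k, ⟨k, l, hkl, h1, h2, h3⟩, fun hh => ?_, fun hh => ?_⟩
      · have : refl k (b k) b = a := by
          ext q
          by_cases hq : q = k
          · subst hq; rw [refl_apply_same]; linear_combination h
          · rw [refl_apply_ne hq, bond_apply_ne h1 hq]
        have hb := hh.2.1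
        rw [← this] at hh
        exact inHalf_refl.1 hh.1 hb
      · exact hh.2.1 (by simp [InHalf, hL])
    · refine ⟨k, a k, ⟨k, l, hkl, h1, h2, h3⟩, fun hh => ?_, fun hh => ?_⟩
      · have : refl k (a k) a = b := by
          ext q
          by_cases hq : q = k
          · subst hq; rw [refl_apply_same]; linear_combination -h
          · rw [refl_apply_ne hq, bond_apply_ne h1 hq]
        have ha := hh.1
        rw [← this] at hh
        exact inHalf_refl.1 hh.2.1 ha
      · exact hh.1 (by simp [InHalf, hL])
  · exact ⟨l, 0, rfl⟩

open Classical in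
/-- The number of loops with the wrong flux. -/
noncomputable def badLoops (U : Torus d L → Torus d L → Circle) : ℕ :=
  (Finset.univ.filter fun i : Loop d L => ¬HasCanonicalFlux U i).card

theorem badLoops_fold_lt {j : Fin d} {p : ZMod (2 * L)} {U : Torus d L → Torus d L → Circle}
    (hU : IsGaugeField U) {i : Loop d L} (hi : ¬HasCanonicalFlux U i) (hcut : IsCut j p i)  :
    badLoops (fold j p U) + badLoops (fold j (p + (L : ZMod (2 * L))) U) < 2 * badLoops U := by
  classical
  have hcut' : ∀ i : Loop d L, IsCut j p i → HasCanonicalFlux (fold j (p + (L : ZMod (2 * L))) U) i := fun i hi => by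
    apply hasCanonicalFlux_fold_of_isCut hU
    have hplus : ∀ x, InHalf j (p + (L : ZMod (2 * L))) x ↔ ¬InHalf j p x := fun x => inHalf_add
    rcases i with ⟨a, b, c, e⟩ | ⟨x, l⟩
    · simp only [IsCut, hplus, not_not] at hi ⊢
      exact ⟨hi.1, hi.2.2, hi.2.1⟩
    · exact hi
  have hrefl : badLoops U = ∑ i : Loop d L, if ¬HasCanonicalFlux U (reflLoop j p i) then 1 else 0 := by
    rw [badLoops, Finset.card_filter]
    exact (Fintype.sum_equiv (Function.Involutive.toPerm (reflLoop j p) reflLoop_reflLoop)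
      _ _ fun i => rfl).symm
  have h0 : ∀ W : Torus d L → Torus d L → Circle,
      badLoops W = ∑ i : Loop d L, if ¬HasCanonicalFlux W i then 1 else 0 := fun W => by
    rw [badLoops, Finset.card_filter]
  have h2 : 2 * badLoops U = badLoops U + ∑ i : Loop d L,
      if ¬HasCanonicalFlux U (reflLoop j p i) then 1 else 0 := by rw [← hrefl, two_mul]
  rw [h2, h0, h0, h0, ← Finset.sum_add_distrib, ← Finset.sum_add_distrib]
  refine Finset.sum_lt_sum (fun i _ => ?_) ⟨i, Finset.mem_univ i, ?_⟩
  · by_cases hc : IsCut j p i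
    · simp [hasCanonicalFlux_fold_of_isCut hU hc, hcut' i hc]
    · rcases hasCanonicalFlux_fold_of_not_isCut (U := U) hc with ⟨h1, h2⟩ | ⟨h1, h2⟩
      · simp only [h1, h2, le_refl]
      · simp only [h1, h2]; rw [add_comm]
  · simp only [hasCanonicalFlux_fold_of_isCut hU hcut, hcut' i hcut, hi, not_true_eq_false,
      not_false_eq_true, if_true, if_false]
    omega

/-- There is a gauge in which all pairs of mirror images carry the phase `-1`: each site of the right
half is mirror image of exactly one site of the left half. -/
theorem exists_gauge_cross {U : Torus d L → Torus d L → Circle} (j : Fin d)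
    (p : ZMod (2 * L)) : ∃ g : Torus d L → Circle, ∀ x, InHalf j p x →
      gaugeTransform g U x (refl j p x) = -1 := by
  classical
  refine ⟨fun x => if InHalf j p x then 1 else -U (refl j p x) x, fun x hx => ?_⟩
  have hx' : ¬InHalf j p (refl j p x) := fun h => inHalf_refl.1 h hx
  simp only [gaugeTransform, hx, hx', if_true, if_false, refl_refl, one_mul]
  simp [inv_neg]

/-- From a maximizer of the partition function one obtains a maximizer with canonical fluxes:
reflecting it in a plane through a loop with wrong flux gives two maximizers, one of which has
fewer wrong fluxes. -/
theorem exists_hasCanonicalFlux_of_maximizer (c : Couplings (Torus d L) K)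
    (hadj : ∀ x y, c.adj x y ↔ ∃ k, Bond k x y) {β : ℝ} (hβ : 0 ≤ β) (m : Torus d L × Spin ≃ M)
    {t : Fin d → ℝ} (ht : ∀ j, 0 ≤ t j) {z : ℝ}
    (hmax : ∀ W, IsGaugeField W → gaugePartition c β m t W ≤ z) (n : ℕ) :
    ∀ U : Torus d L → Torus d L → Circle, IsGaugeField U → gaugePartition c β m t U = z →
      badLoops U = n → ∃ U' : Torus d L → Torus d L → Circle, IsGaugeField U' ∧
        gaugePartition c β m t U' = z ∧ ∀ i, HasCanonicalFlux U' i := by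
  induction n using Nat.strong_induction_on with
  | _ n ih =>
    intro U₀ hU₀ hz₀ hn₀
    by_cases hgood : ∀ i, HasCanonicalFlux U₀ i
    · exact ⟨U₀, hU₀, hz₀, hgood⟩
    obtain ⟨i, hi₀⟩ := not_forall.1 hgood
    obtain ⟨j, p, hcut⟩ := exists_isCut i hi₀
    obtain ⟨g, hcross⟩ := exists_gauge_cross (U := U₀) j p
    obtain ⟨U, hUdef⟩ : ∃ U, U = gaugeTransform g U₀ := ⟨_, rfl⟩
    have hU : IsGaugeField U := hUdef ▸ hU₀.gaugeTransform g
    rw [← hUdef] at hcross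
    have hz : gaugePartition c β m t U = z := by rw [hUdef, gaugePartition_gaugeTransform, hz₀]
    have hi : ¬HasCanonicalFlux U i := by rwa [hUdef, hasCanonicalFlux_gaugeTransform]
    have hn : badLoops U = n := by
      classical
      rw [hUdef, ← hn₀]
      exact congrArg Finset.card <| Finset.filter_congr fun i _ =>
        not_congr (hasCanonicalFlux_gaugeTransform g i)
    have hsq := gaugePartition_sq_le c hadj hβ m ht hU hcross
    rw [hz] at hsq
    have hpos : 0 < z := hz ▸ (gaugePartition_pos (t := t) c hadj β m hU).2
    have hFl := isGaugeField_fold (j := j) (p := p) hU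
    have hFr := isGaugeField_fold (j := j) (p := p + (L : ZMod (2 * L))) hU
    have hl := hmax _ hFl
    have hr := hmax _ hFr
    have hl' := eq_of_sq_le_mul hpos (gaugePartition_pos c hadj β m hFl).2.le hl hr hsq
    have hr' := eq_of_sq_le_mul hpos (gaugePartition_pos c hadj β m hFr).2.le hr hl
      (by rwa [mul_comm])
    have hlt := badLoops_fold_lt hU hi hcut
    rw [hn] at hlt
    by_cases h : badLoops (fold j p U) < n
    · exact ih _ h _ hFl hl' rfl
    · exact ih (badLoops (fold j (p + (L : ZMod (2 * L))) U)) (by omega) _ hFr hr' rfl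

theorem isClosed_setOf_isGaugeField {V : Type} : IsClosed {U : V → V → Circle | IsGaugeField U} := by
  simp only [IsGaugeField, Set.ofPred_forall]
  refine isClosed_iInter fun x => isClosed_iInter fun y => isClosed_eq ?_ ?_
  · exact continuous_apply_apply y x
  · exact (continuous_apply_apply x y).inv

/-- The partition function attains its maximum at a gauge field with canonical fluxes. -/
theorem exists_maximizer (c : Couplings (Torus d L) K)
    (hadj : ∀ x y, c.adj x y ↔ ∃ k, Bond k x y) {β : ℝ} (hβ : 0 ≤ β) (m : Torus d L × Spin ≃ M)
    {t : Fin d → ℝ} (ht : ∀ j, 0 ≤ t j) :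
    ∃ U : Torus d L → Torus d L → Circle, IsGaugeField U ∧ (∀ i, HasCanonicalFlux U i) ∧
      ∀ W, IsGaugeField W → gaugePartition c β m t W ≤ gaugePartition c β m t U := by
  have hcompact := (isClosed_setOf_isGaugeField (V := Torus d L)).isCompact
  have hne : IsGaugeField (fun _ _ => 1 : Torus d L → Torus d L → Circle) :=
    fun _ _ => inv_one.symm
  have hcont := continuous_gaugePartition (t := t) c β m
  obtain ⟨U₀, hU₀, hmax₀⟩ := hcompact.exists_isMaxOn ⟨_, hne⟩ hcont.continuousOn
  have hmax : ∀ W, IsGaugeField W → gaugePartition c β m t W ≤ gaugePartition c β m t U₀ :=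
    fun W hW => isMaxOn_iff.1 hmax₀ W hW
  obtain ⟨U, hU, hz, hgood⟩ :=
    exists_hasCanonicalFlux_of_maximizer c hadj hβ m ht hmax _ U₀ hU₀ rfl rfl
  exact ⟨U, hU, hgood, fun W hW => (hmax W hW).trans hz.ge⟩

end Maximizer

/-! ### Gauge fields with equal fluxes are gauge equivalent -/

section GaugeEquivalence

variable {d L : ℕ} [NeZero L]

/-- A flat lattice connection `a` on the torus whose holonomies along all large circles are trivial
is a pure gauge in any set of directions. The directions are treated one after another: once `a`
is trivial in the directions of `s`, its component in another direction `l` is constant along `s`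
by flatness, and is trivialised by the holonomy along `l` from the layer `x l = 0` on. -/
theorem exists_gauge_of_flat (a : Fin d → Torus d L → Circle)
    (hflat : ∀ j k x, j ≠ k →
      a j x * a k (x + Pi.single j 1) = a k x * a j (x + Pi.single k 1))
    (hcirc : ∀ l x, ∏ s : ZMod (2 * L), a l (Function.update x l s) = 1) (s : Finset (Fin d)) :
    ∃ g : Torus d L → Circle, ∀ l ∈ s, ∀ x, a l x = g (x + Pi.single l 1) * (g x)⁻¹ := by
  induction s using Finset.induction_on with
  | empty => exact ⟨1, by simp⟩
  | insert l s hl ih =>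
    obtain ⟨g, hg⟩ := ih
    set b : Fin d → Torus d L → Circle :=
      fun k x => a k x * (g (x + Pi.single k 1) * (g x)⁻¹)⁻¹ with hb
    have hb1 : ∀ k ∈ s, ∀ x, b k x = 1 := fun k hk x => by
      simp only [hb, hg k hk x, mul_inv_cancel]
    have hbflat : ∀ k ∈ s, ∀ x, b l (x + Pi.single k 1) = b l x := fun k hk x => by
      have hkl : k ≠ l := fun h => hl (h ▸ hk)
      have h := hflat k l x hkl
      rw [hg k hk, hg k hk] at h
      simp only [hb]
      have hcomm : x + Pi.single k 1 + Pi.single l 1 = x + Pi.single l 1 + Pi.single k 1 := by abel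
      rw [hcomm]
      rw [mul_inv_rev, mul_inv_rev, inv_inv, inv_inv]
      set A := a l (x + Pi.single k 1)
      set B := a l x
      have hA : A = B * (g (x + Pi.single l 1 + Pi.single k 1) * (g (x + Pi.single l 1))⁻¹)
          * (g (x + Pi.single k 1) * (g x)⁻¹)⁻¹ := by
        rw [← h]; rw [mul_comm _ A, mul_assoc, mul_inv_cancel, mul_one]
      rw [hA]
      apply Circle.ext
      simp only [Circle.coe_mul, Circle.coe_inv]
      field_simp [Circle.coe_ne_zero]
    have hbcirc : ∀ x, ∏ s : ZMod (2 * L), b l (Function.update x l s) = 1 := fun x => by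
      have hup : ∀ s : ZMod (2 * L), Function.update x l s + Pi.single l 1
          = Function.update x l (s + 1) := fun s => by
        ext q
        by_cases hq : q = l
        · subst hq; simp
        · simp [hq]
      have hshift : ∏ s : ZMod (2 * L), g (Function.update x l (s + 1))
          = ∏ s : ZMod (2 * L), g (Function.update x l s) :=
        Fintype.prod_equiv (Equiv.addRight 1) _ _ fun s => rfl
      simp only [hb, hup]
      rw [Finset.prod_mul_distrib, Finset.prod_inv_distrib, Finset.prod_mul_distrib,
        Finset.prod_inv_distrib, hshift, hcirc]
      simp
    set h : Torus d L → Circle :=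
      fun x => ∏ i ∈ Finset.range (x l).val, b l (Function.update x l (i : ZMod (2 * L))) with hh
    have hhl : ∀ x, h (x + Pi.single l 1) = h x * b l x := fun x => by
      have hup : ∀ i : ZMod (2 * L), Function.update (x + Pi.single l 1) l i
          = Function.update x l i := fun i => by
        ext q
        by_cases hq : q = l
        · subst hq; simp
        · simp [hq]
      have hself : Function.update x l (((x l).val : ℕ) : ZMod (2 * L)) = x := by
        rw [ZMod.natCast_zmod_val, Function.update_eq_self]
      have hstep : h x * b l x
          = ∏ i ∈ Finset.range ((x l).val + 1), b l (Function.update x l (i : ZMod (2 * L))) := by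
        rw [Finset.prod_range_succ, hself]
      rw [hstep]
      simp only [hh, hup, Pi.add_apply, Pi.single_eq_same]
      by_cases hlt : (x l).val + 1 < 2 * L
      · rw [val_add_one hlt]
      · have h1 : (x l).val + 1 = 2 * L := by have := (x l).val_lt; omega
        have h2 : x l + 1 = 0 := by
          rw [← ZMod.natCast_zmod_val (x l), ← Nat.cast_succ, Nat.succ_eq_add_one, h1,
            ZMod.natCast_self]
        rw [h2, ZMod.val_zero, h1, ← prod_zmod (2 * L) fun i => b l (Function.update x l i), hbcirc]
        simp
    have hhk : ∀ k ∈ s, ∀ x, h (x + Pi.single k 1) = h x := fun k hk x => by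
      have hkl : l ≠ k := fun h => hl (h ▸ hk)
      have hup : ∀ i : ZMod (2 * L), Function.update (x + Pi.single k 1) l i
          = Function.update x l i + Pi.single k 1 := fun i => by
        ext q
        by_cases hq : q = l
        · subst hq; simp [hkl]
        · simp [hq]
      simp only [hh, hup, hbflat k hk, Pi.add_apply, Pi.single_eq_of_ne hkl, add_zero]
    refine ⟨g * h, fun k hk x => ?_⟩
    simp only [Pi.mul_apply]
    have hab : a k x = b k x * (g (x + Pi.single k 1) * (g x)⁻¹) := by
      simp only [hb]; rw [inv_mul_cancel_right]
    rw [hab, mul_inv]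
    rcases Finset.mem_insert.1 hk with rfl | hk
    · rw [hhl]
      apply Circle.ext
      simp only [Circle.coe_mul, Circle.coe_inv]
      field_simp [Circle.coe_ne_zero]
    · rw [hhk k hk, hb1 k hk]
      apply Circle.ext
      simp only [Circle.coe_mul, Circle.coe_inv, Circle.coe_one]
      field_simp [Circle.coe_ne_zero]

theorem exists_gaugeTransform_of_flux_eq {U W : Torus d L → Torus d L → Circle}
    (hU : IsGaugeField U) (hW : IsGaugeField W)
    (hcorner : ∀ (x : Torus d L) (j k : Fin d), j < k →
      cornerFlux U x (x + Pi.single j 1) (x + Pi.single j 1 + Pi.single k 1) (x + Pi.single k 1)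
        = cornerFlux W x (x + Pi.single j 1) (x + Pi.single j 1 + Pi.single k 1)
          (x + Pi.single k 1))
    (hloop : ∀ x l, loopFlux U x l = loopFlux W x l) :
    ∃ g : Torus d L → Circle, ∀ k x y, Bond k x y → U x y = gaugeTransform g W x y := by
  obtain ⟨g, hg⟩ := exists_gauge_of_flat
    (fun l x => U (x + Pi.single l 1) x * (W (x + Pi.single l 1) x)⁻¹) (by
      suffices h : ∀ (j k : Fin d) (x : Torus d L), j < k →
          U (x + Pi.single j 1) x * (W (x + Pi.single j 1) x)⁻¹
            * (U (x + Pi.single j 1 + Pi.single k 1) (x + Pi.single j 1)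
              * (W (x + Pi.single j 1 + Pi.single k 1) (x + Pi.single j 1))⁻¹)
          = U (x + Pi.single k 1) x * (W (x + Pi.single k 1) x)⁻¹
            * (U (x + Pi.single k 1 + Pi.single j 1) (x + Pi.single k 1)
              * (W (x + Pi.single k 1 + Pi.single j 1) (x + Pi.single k 1))⁻¹) by
        intro j k x hjk
        rcases lt_or_gt_of_ne hjk with h1 | h1
        · exact h j k x h1
        · exact (h k j x h1).symm
      intro j k x hjk
      have h := hcorner x j k hjk
      have hcomm : x + Pi.single k 1 + Pi.single j 1 = x + Pi.single j 1 + Pi.single k 1 := by abel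
      unfold cornerFlux at h
      rw [hU (x + Pi.single j 1 + Pi.single k 1) (x + Pi.single k 1), hU (x + Pi.single k 1) x,
        hW (x + Pi.single j 1 + Pi.single k 1) (x + Pi.single k 1), hW (x + Pi.single k 1) x] at h
      rw [hcomm]
      have h' := congrArg (fun z : Circle => (z : ℂ)) h
      simp only [Circle.coe_mul, Circle.coe_inv] at h'
      apply Circle.ext
      simp only [Circle.coe_mul, Circle.coe_inv]
      field_simp [Circle.coe_ne_zero] at h' ⊢
      linear_combination h') (by
      intro l x
      have hup : ∀ s : ZMod (2 * L), Function.update x l s + Pi.single l 1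
          = Function.update x l (s + 1) := fun s => by
        ext q
        by_cases hq : q = l
        · subst hq; simp
        · simp [hq]
      have h := hloop x l
      unfold loopFlux at h
      simp only [hup]
      rw [Finset.prod_mul_distrib, Finset.prod_inv_distrib, h, mul_inv_cancel]) Finset.univ
  have key : ∀ k x, U (x + Pi.single k 1) x = gaugeTransform g W (x + Pi.single k 1) x := by
    intro k x
    have h := hg k (Finset.mem_univ k) x
    rw [mul_inv_eq_iff_eq_mul] at h
    rw [h, gaugeTransform, mul_right_comm]
  refine ⟨g, fun k x y hxy => ?_⟩
  rcases hxy with h | h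
  · rw [eq_add_of_sub_eq' h]; exact key k y
  · have : y = x + Pi.single k 1 := by rw [sub_eq_iff_eq_add] at h; rw [h]; abel
    rw [this, hU (x + Pi.single k 1) x, key, ← hW.gaugeTransform g]

/-- The partition function only depends on the fluxes of the gauge field. -/
theorem gaugePartition_eq_of_flux_eq {K M : Type} [Fintype K] [Fintype M] [LinearOrder M]
    {U W : Torus d L → Torus d L → Circle} (hU : IsGaugeField U) (hW : IsGaugeField W)
    (hcorner : ∀ (x : Torus d L) (j k : Fin d), j < k →
      cornerFlux U x (x + Pi.single j 1) (x + Pi.single j 1 + Pi.single k 1) (x + Pi.single k 1)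
        = cornerFlux W x (x + Pi.single j 1) (x + Pi.single j 1 + Pi.single k 1)
          (x + Pi.single k 1))
    (hloop : ∀ x l, loopFlux U x l = loopFlux W x l) (c : Couplings (Torus d L) K) (β : ℝ)
    (m : Torus d L × Spin ≃ M) (t : Fin d → ℝ) :
    gaugePartition c β m t U = gaugePartition c β m t W := by
  obtain ⟨g, hg⟩ := exists_gaugeTransform_of_flux_eq hU hW hcorner hloop
  have h : amplitude t U = amplitude t (gaugeTransform g W) := by
    funext x y
    by_cases hxy : ∃ k, Bond k x y
    · obtain ⟨k, hk⟩ := hxy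
      rw [amplitude, amplitude, hg k x y hk]
    · rw [amplitude, amplitude, bondWeight_eq_zero (not_exists.1 hxy)]
      simp
  rw [← gaugePartition_gaugeTransform c β m g (U := W), gaugePartition, gaugePartition, h]

end GaugeEquivalence

/-! ### Phases on `ℤ^d` as gauge fields on the torus -/

section Phases

variable {d L : ℕ}

/-- A point of `ℤ^d` as a point of the torus. -/
def toTorus (L : ℕ) (x : Fin d → ℤ) : Torus d L := fun k => (x k : ZMod (2 * L))

theorem toTorus_add (x y : Fin d → ℤ) : toTorus L (x + y) = toTorus L x + toTorus L y := by
  funext k; simp [toTorus]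

theorem toTorus_basisVec (j : Fin d) : toTorus L (basisVec j) = Pi.single j 1 := by
  funext k
  by_cases h : k = j
  · subst h; simp [toTorus, basisVec]
  · simp [toTorus, basisVec, h]

theorem circle_exp_pi : Circle.exp π = -1 := by
  apply Circle.ext
  rw [Circle.coe_exp, Complex.exp_pi_mul_I]
  rfl

theorem exp_canonical : Circle.exp (if Even L then π else 0) = -(-1) ^ L := by
  split_ifs with h
  · rw [circle_exp_pi, h.neg_one_pow]
  · rw [Circle.exp_zero, (Nat.not_even_iff_odd.1 h).neg_one_pow, neg_neg]

theorem isPlaquette_standard (x : Torus d L) {j k : Fin d} (hjk : j ≠ k) :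
    IsPlaquette x (x + Pi.single j 1) (x + Pi.single j 1 + Pi.single k 1) (x + Pi.single k 1) :=
  ⟨j, k, hjk, Or.inl (by abel), Or.inl (by abel), by abel⟩

theorem exp_eq_of_modEq {a b : ℝ} (h : a ≡ b [PMOD (2 * π)]) : Circle.exp a = Circle.exp b := by
  obtain ⟨z, hz⟩ := AddCommGroup.modEq_iff_zsmul'.1 h.symm
  refine Circle.exp_eq_exp.2 ⟨z, ?_⟩
  rw [zsmul_eq_mul] at hz
  linarith

variable [NeZero L]

/-- The sites as points of the torus. -/
def siteEquiv (d L : ℕ) [NeZero L] : Site d L ≃ Torus d L where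
  toFun x k := ((x k : ℕ) : ZMod (2 * L))
  invFun v k := ⟨(v k).val, (v k).val_lt⟩
  left_inv x := by
    ext k
    simp [ZMod.val_natCast_of_lt (x k).isLt]
  right_inv v := by
    ext k
    simp

theorem toTorus_toInt (x : Site d L) : toTorus L x.toInt = siteEquiv d L x := by
  funext k
  simp [toTorus, Site.toInt, siteEquiv]

theorem isBond_iff (j : Fin d) (x y : Site d L) :
    IsBond j x y ↔ Bond j (siteEquiv d L x) (siteEquiv d L y) := by
  have h : (fun k => ((x.toInt k - y.toInt k : ℤ) : ZMod (2 * L)))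
      = siteEquiv d L x - siteEquiv d L y := by
    funext k
    simp [Site.toInt, siteEquiv]
  rw [IsBond, Bond, h]

/-- The gauge field of a phase. -/
noncomputable def gaugeField (L : ℕ) [NeZero L] (φ : Phase d) (x y : Torus d L) : Circle :=
  Circle.exp (φ ((siteEquiv d L).symm x).toInt ((siteEquiv d L).symm y).toInt)

variable {φ : Phase d}

theorem isGaugeField_gaugeField (hφ : IsAdmissible L φ) : IsGaugeField (gaugeField L φ) :=
  fun x y => by
    rw [gaugeField, gaugeField, exp_eq_of_modEq (hφ.antisymm _ _), Circle.exp_neg]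

theorem exists_toInt_add (x : Fin d → ℤ) :
    ∃ m : Fin d → ℤ, x = ((siteEquiv d L).symm (toTorus L x)).toInt + (2 * (L : ℤ)) • m := by
  refine ⟨fun k => x k / (2 * L), ?_⟩
  funext k
  have h : (((siteEquiv d L).symm (toTorus L x)).toInt k) = x k % (2 * L) := by
    change (((x k : ZMod (2 * L)).val : ℕ) : ℤ) = _
    rw [ZMod.val_intCast]
    push_cast
    rfl
  rw [Pi.add_apply, h, Pi.smul_apply, smul_eq_mul, Int.emod_add_mul_ediv]

/-- An admissible phase is periodic in both arguments. -/
theorem exp_phase (hφ : IsAdmissible L φ) (x y : Fin d → ℤ) :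
    Circle.exp (φ x y) = gaugeField L φ (toTorus L x) (toTorus L y) := by
  obtain ⟨m, hm⟩ := exists_toInt_add (L := L) x
  obtain ⟨m', hm'⟩ := exists_toInt_add (L := L) y
  set x' := ((siteEquiv d L).symm (toTorus L x)).toInt with hx'
  set y' := ((siteEquiv d L).symm (toTorus L y)).toInt with hy'
  rw [gaugeField, ← hx', ← hy', hm, hm', exp_eq_of_modEq (hφ.periodic _ _ _),
    exp_eq_of_modEq (hφ.antisymm _ _), Circle.exp_neg, exp_eq_of_modEq (hφ.periodic _ _ _),
    exp_eq_of_modEq (hφ.antisymm y' x'), Circle.exp_neg, inv_inv]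

theorem exists_toTorus_eq (x : Torus d L) : ∃ v, toTorus L v = x :=
  ⟨((siteEquiv d L).symm x).toInt, by rw [toTorus_toInt, Equiv.apply_symm_apply]⟩

theorem exp_plaquetteFlux (hφ : IsAdmissible L φ) (j k : Fin d) (v : Fin d → ℤ) :
    Circle.exp (plaquetteFlux φ j k v)
      = cornerFlux (gaugeField L φ) (toTorus L v) (toTorus L v + Pi.single j 1)
          (toTorus L v + Pi.single j 1 + Pi.single k 1) (toTorus L v + Pi.single k 1) := by
  rw [plaquetteFlux, Circle.exp_add, Circle.exp_add, Circle.exp_add]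
  simp only [exp_phase hφ, toTorus_add, toTorus_basisVec]
  rfl

theorem exp_circleFlux (hφ : IsAdmissible L φ) (l : Fin d) (v : Fin d → ℤ) :
    Circle.exp (circleFlux L φ l v) = loopFlux (gaugeField L φ) (toTorus L v) l := by
  have hup : ∀ s : ℤ, toTorus L (v + s • basisVec l)
      = Function.update (toTorus L v) l (toTorus L v l + s) := fun s => by
    funext k
    by_cases h : k = l
    · subst h; simp [toTorus, basisVec]
    · simp [toTorus, basisVec, h]
  rw [loopFlux, ← Fintype.prod_equiv (Equiv.addLeft (toTorus L v l))
    (fun s => gaugeField L φ (Function.update (toTorus L v) l (toTorus L v l + s + 1))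
      (Function.update (toTorus L v) l (toTorus L v l + s))) _ fun s => rfl, prod_zmod]
  have hsum : ∀ (s : Finset ℕ) (f : ℕ → ℝ), Circle.exp (∑ i ∈ s, f i) = ∏ i ∈ s, Circle.exp (f i) :=
    fun s f => by
      induction s using Finset.induction_on with
      | empty => simp
      | insert i s hi ih => rw [Finset.sum_insert hi, Finset.prod_insert hi, Circle.exp_add, ih]
  rw [circleFlux, hsum]
  refine Finset.prod_congr rfl fun i _ => ?_
  rw [exp_phase hφ, hup, hup]
  push_cast
  rw [add_assoc]

/-! ### The Hamiltonian in terms of gauge fields -/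

/-- The couplings of the interaction: `none` labels the density-density interaction and `some j` the
spin-spin interactions. -/
noncomputable def torusCouplings (d L : ℕ) (Uo Ud : ℝ) (Us : Fin 3 → ℝ) (hUd : 0 ≤ Ud)
    (hUs : ∀ j, 0 ≤ Us j) : Couplings (Torus d L) (Option (Fin 3)) where
  adj x y := ∃ k, Bond k x y
  onsite := Uo
  strength k := k.elim Ud Us
  mat k := k.elim 1 pauli
  shift k := k.elim 1 fun _ => 0
  strength_nonneg k := by cases k <;> simp [hUd, hUs]
  mat_hermitian k := by
    rcases k with _ | j
    · exact Matrix.isHermitian_one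
    · ext a b
      fin_cases j <;> fin_cases a <;> fin_cases b <;> simp [pauli]
  trace_mat k := by
    rcases k with _ | j
    · simp
    · fin_cases j <;> simp [pauli, Matrix.trace_fin_two]

/-- The labelling of the modes by points of the torus. -/
def modeEquiv (d L : ℕ) [NeZero L] : Torus d L × Spin ≃ Mode d L where
  toFun p := mode ((siteEquiv d L).symm p.1) p.2
  invFun a := (siteEquiv d L (ofLex (ofLex a).1), (ofLex a).2)
  left_inv p := by simp [mode]
  right_inv a := by simp [mode]

theorem hamiltonian_eq (t : Fin d → ℝ) (Uo Ud : ℝ) (Us : Fin 3 → ℝ) (hUd : 0 ≤ Ud)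
    (hUs : ∀ j, 0 ≤ Us j) (φ : Phase d) :
    hamiltonian L t Uo Ud Us φ = hubbard (torusCouplings d L Uo Ud Us hUd hUs)
      (amplitude t (gaugeField L φ)) (bilinear (modeEquiv d L)) := by
  classical
  rw [← hubbard_comap (siteEquiv d L)]
  have hB : (fun x σ y τ => bilinear (modeEquiv d L) (siteEquiv d L x) σ (siteEquiv d L y) τ)
      = fun (x : Site d L) σ (y : Site d L) τ => creation (mode x σ) * annihilation (mode y τ) := by
    funext x σ y τ
    simp [bilinear, modeEquiv]
  have hadj : ∀ x y : Site d L, (∃ k, Bond k (siteEquiv d L x) (siteEquiv d L y))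
      ↔ ∃ k, IsBond k x y := fun x y => by simp only [isBond_iff]
  have hamp : ∀ x y : Site d L, amplitude t (gaugeField L φ) (siteEquiv d L x) (siteEquiv d L y)
      = ∑ j, if IsBond j x y then
        (t j : ℂ) * Complex.exp (Complex.I * (φ x.toInt y.toInt : ℂ)) else 0 := fun x y => by
    rw [amplitude, bondWeight, gaugeField, Circle.coe_exp, Equiv.symm_apply_apply,
      Equiv.symm_apply_apply, Complex.ofReal_sum, Finset.sum_mul, mul_comm Complex.I]
    refine Finset.sum_congr rfl fun j _ => ?_
    by_cases h : IsBond j x y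
    · rw [if_pos h, if_pos ((isBond_iff j x y).1 h)]
    · rw [if_neg h, if_neg (fun h2 => h ((isBond_iff j x y).2 h2))]; simp
  rw [hB, hamiltonian, hubbard, add_assoc]
  congr 1
  · rw [freeHamiltonian, hopping]
    refine Finset.sum_congr rfl fun x _ => Finset.sum_congr rfl fun y _ =>
      Finset.sum_congr rfl fun σ _ => ?_
    rw [hamp, Finset.sum_smul]
    refine Finset.sum_congr rfl fun j _ => ?_
    split_ifs <;> simp
  · rw [interaction, Fintype.sum_option, ← add_assoc]
    congr 1
    · congr 1
      rw [pairInteraction]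
      congr 1
      refine Finset.sum_congr rfl fun x _ => Finset.sum_congr rfl fun y _ => ?_
      refine if_congr (hadj x y).symm ?_ rfl
      simp [siteObs, torusCouplings, Couplings.comap, number, Fin.sum_univ_two, Matrix.one_apply]
    · refine Finset.sum_congr rfl fun j _ => ?_
      rw [pairInteraction]
      congr 1
      refine Finset.sum_congr rfl fun x _ => Finset.sum_congr rfl fun y _ => ?_
      by_cases h : ∃ k, IsBond k x y
      · have h' : ((torusCouplings d L Uo Ud Us hUd hUs).comap (siteEquiv d L)).adj x y :=
          (hadj x y).2 h
        simp only [if_pos h, if_pos h']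
        simp [siteObs, torusCouplings, Couplings.comap, Fin.sum_univ_two, add_mul, mul_add]
        abel
      · have h' : ¬((torusCouplings d L Uo Ud Us hUd hUs).comap (siteEquiv d L)).adj x y :=
          fun h2 => h ((hadj x y).1 h2)
        simp only [if_neg h, if_neg h']
        simp

theorem partitionFunction_eq (t : Fin d → ℝ) (Uo Ud : ℝ) (Us : Fin 3 → ℝ) (hUd : 0 ≤ Ud)
    (hUs : ∀ j, 0 ≤ Us j) (β : ℝ) (φ : Phase d) :
    partitionFunction L t Uo Ud Us β φ = partition (torusCouplings d L Uo Ud Us hUd hUs) β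
      (modeEquiv d L) (amplitude t (gaugeField L φ)) := by
  rw [partitionFunction, partition, hamiltonian_eq t Uo Ud Us hUd hUs φ]
  -- the two sides use different instances of decidable equality of modes
  congr!

end Phases

end FluxPhase

theorem theoremB (d L : ℕ) (hd : 2 ≤ d) (hL : 1 ≤ L)
    (t : Fin d → ℝ) (ht : ∀ j, 0 < t j)
    (Uo Ud : ℝ) (Us : Fin 3 → ℝ) (hUd : 0 ≤ Ud) (hUs : ∀ j, 0 ≤ Us j)
    (β : ℝ) (hβ : 0 < β)
    (θ : FluxPhase.Phase d) (hθ : FluxPhase.IsAdmissible L θ)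
    (hplaquette : ∀ (x : Fin d → ℤ) (j k : Fin d), j < k →
      FluxPhase.plaquetteFlux θ j k x ≡ π [PMOD (2 * π)])
    (hcircle : ∀ (x : Fin d → ℤ) (l : Fin d),
      FluxPhase.circleFlux L θ l x ≡ (if Even L then π else 0) [PMOD (2 * π)]) :
    (∀ φ : FluxPhase.Phase d, FluxPhase.IsAdmissible L φ →
      (FluxPhase.partitionFunction L t Uo Ud Us β φ).im = 0 ∧
        0 < (FluxPhase.partitionFunction L t Uo Ud Us β φ).re) ∧
    IsLeast
      {F : ℝ | ∃ φ : FluxPhase.Phase d, FluxPhase.IsAdmissible L φ ∧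
        F = FluxPhase.freeEnergy L t Uo Ud Us β φ}
      (FluxPhase.freeEnergy L t Uo Ud Us β θ) := by
  have : NeZero L := ⟨by omega⟩
  set c := FluxPhase.torusCouplings d L Uo Ud Us hUd hUs with hc
  have hadj : ∀ x y, c.adj x y ↔ ∃ k, FluxPhase.Bond k x y := fun x y => Iff.rfl
  have hZ : ∀ φ, FluxPhase.partitionFunction L t Uo Ud Us β φ = FluxPhase.partition c β
      (FluxPhase.modeEquiv d L) (FluxPhase.amplitude t (FluxPhase.gaugeField L φ)) :=
    FluxPhase.partitionFunction_eq t Uo Ud Us hUd hUs β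
  have hpos : ∀ φ : FluxPhase.Phase d, FluxPhase.IsAdmissible L φ →
      (FluxPhase.partitionFunction L t Uo Ud Us β φ).im = 0 ∧
        0 < (FluxPhase.partitionFunction L t Uo Ud Us β φ).re := fun φ hφ => by
    rw [hZ]
    exact FluxPhase.gaugePartition_pos c hadj β _ (FluxPhase.isGaugeField_gaugeField hφ)
  refine ⟨hpos, ⟨θ, hθ, rfl⟩, ?_⟩
  rintro _ ⟨φ, hφ, rfl⟩
  obtain ⟨U, hU, hflux, hmax⟩ := FluxPhase.exists_maximizer c hadj hβ.le
    (FluxPhase.modeEquiv d L) (fun j => (ht j).le)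
  have hmaxθ : FluxPhase.gaugePartition c β (FluxPhase.modeEquiv d L) t U
      = FluxPhase.gaugePartition c β (FluxPhase.modeEquiv d L) t (FluxPhase.gaugeField L θ) := by
    refine FluxPhase.gaugePartition_eq_of_flux_eq hU (FluxPhase.isGaugeField_gaugeField hθ)
      (fun x j k hjk => ?_) (fun x l => ?_) c β _ t
    · obtain ⟨v, rfl⟩ := FluxPhase.exists_toTorus_eq x
      rw [← FluxPhase.exp_plaquetteFlux hθ, FluxPhase.exp_eq_of_modEq (hplaquette v j k hjk),
        FluxPhase.circle_exp_pi]
      exact hflux (Sum.inl (_, _, _, _)) (FluxPhase.isPlaquette_standard _ hjk.ne)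
    · obtain ⟨v, rfl⟩ := FluxPhase.exists_toTorus_eq x
      rw [← FluxPhase.exp_circleFlux hθ, FluxPhase.exp_eq_of_modEq (hcircle v l),
        FluxPhase.exp_canonical]
      exact hflux (Sum.inr (_, l))
  have hle : (FluxPhase.partitionFunction L t Uo Ud Us β φ).re
      ≤ (FluxPhase.partitionFunction L t Uo Ud Us β θ).re := by
    rw [hZ, hZ]
    exact (hmax _ (FluxPhase.isGaugeField_gaugeField hφ)).trans hmaxθ.le
  rw [FluxPhase.freeEnergy, FluxPhase.freeEnergy]
  have hlog := Real.log_le_log (hpos φ hφ).2 hle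
  have hβ' : 0 ≤ 1 / β := by positivity
  nlinarith
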